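/- Let $\Omega\subset\mathbb R^n$, $n\ge 3$, be a bounded open set and $E\subset\Omega$ a compact set. Write $f^+=\operatorname{ess\,sup}_\Omega f$, $f^-=\operatorname{ess\,inf}_\Omega f$, and let $L^\infty_+(\Omega)$ be the set of $p\in L^\infty(\Omega)$ with $p^->1$. Let $p,q_1,q_2,q_3\in L^\infty_+(\Omega)$, let $\alpha,\beta:\Omega\to[0,n]$ be measurable, and let $\vartheta\in W_p(\Omega)$, that is, $\vartheta\in L^1_{\rm loc}(\Omega)$, $\vartheta>0$ a.e. in $\Omega$, and $\vartheta^{-1/(p-1)}\in L^1_{\rm loc}(\Omega)$. $L^{p(\cdot)}(\Omega,\vartheta)$ is the set of measurable $u$ with $\int_\Omega|tu|^{p(x)}\vartheta\,dx<\infty$ for some $t>0$, and $W^{1,p(\cdot)}(\Omega,\vartheta)$ is the set of weakly differentiable $u\in L^{p(\cdot)}(\Omega,\vartheta)$ with $|\nabla u|\in L^{p(\cdot)}(\Omega,\vartheta)$; the subscript "loc" denotes the local version of a space. A function "has an integral" if it is measurable and its positive part or its negative part has finite integral. $W^{1,p(\cdot)}_{E,\rm loc}(\Omega,\vartheta)$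 is the set of $u:\Omega\to\overline{\mathbb R}$ that have an integral over $\Omega$, satisfy $u|_{\Omega\setminus E}\in W^{1,p(\cdot)}_{\rm loc}(\Omega\setminus E,\vartheta)$, and for which there is $\widetilde{\nabla u}:\Omega\to\overline{\mathbb R}^n$, each of whose components has an integral over $\Omega$, with $\widetilde{\nabla u}=\nabla u$ a.e. on $\Omega\setminus E$. Let $A:\Omega\times[0,\infty)\times\mathbb R^n\to\mathbb R^n$ and $B:\Omega\times[0,\infty)\to\mathbb R$ be measurable (Lebesgue in $x$, Borel in the other variables), let $\mu>0$, $a_i\in L^{q_i(\cdot)}(\Omega,\vartheta)$ ($i=1,2,3$), $a_2,a_3\ge0$, and suppose that for almost every $x\in\Omega$, all $s\ge0$ and all $\eta\in\mathbb R^n$, $$\langle A(x,s,\eta),\eta\rangle\ge\big(\mu|\eta|^{p(x)}-\mu^{-1}s^{p(x)}+a_1(x)\big)\vartheta(x),$$ $$|A(x,s,\eta)|\le\big(\mu^{-1}|\eta|^{p(x)-1}+\mu^{-1}s^{p(x)-1}+a_2(x)\big)\vartheta(x),$$ $$|B(x,s)|\le\big(\mu^{-1}s^{p(x)-1}+a_3(x)\big)\vartheta(x).$$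 Suppose moreover that $$(p\beta)^+\le n-\alpha^+-p^+-1,\qquad q_1^-,\,q_3^-\ge\Big(\frac p{p-1}\Big)^+,\qquad q_2^-\ge\max\Big\{\Big(\frac p{p-1}\Big)^+,\ \frac{n-\alpha^+}{n-\alpha^+-\beta^+-2}\Big\},$$ and that the $(\alpha,\vartheta)$-upper Minkowski content of $E$ vanishes: $$\limsup_{\varepsilon\to0^+}\int_{\{x\,:\,d(x,E)<\varepsilon\}}\varepsilon^{\alpha(x)-n}\vartheta(x)\,dx=0.$$ Let $u\in W^{1,p(\cdot)}_{E,\rm loc}(\Omega,\vartheta)$ be a non-negative weak sub-solution of $-\operatorname{div}A(x,u,\nabla u)+B(x,u)=0$ in $\Omega\setminus E$, i.e. $$\int_{\Omega\setminus E}\langle A(x,u,\nabla u),\nabla\varphi\rangle+B(x,u)\varphi\,dx\le0$$ for all $\varphi\in W^{1,p(\cdot)}(\Omega,\vartheta)$, $\varphi\ge0$, with compact support in $\Omega\setminus E$, and suppose that for some constant $C>0$ $$u(x)\le C\,d(x,E)^{-\beta(x)}\quad\text{for a.e. }x\in\Omega\setminus E.$$ Then the singularity of $u$ at $E$ is removable: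 $u\in W^{1,p(\cdot)}_{\rm loc}(\Omega,\vartheta)$, and $$\int_{\Omega}\langle A(x,u,\nabla u),\nabla\varphi\rangle+B(x,u)\varphi\,dx\le0$$ for all $\varphi\in W^{1,p(\cdot)}(\Omega,\vartheta)$, $\varphi\ge0$, with compact support in $\Omega$. The integrands in both inequalities are integrable. -/

import Mathlib

open MeasureTheory Filter Topology
open scoped ENNReal

noncomputable section

/-- Euclidean space `ℝⁿ`. -/
abbrev Rn (n : ℕ) : Type := EuclideanSpace ℝ (Fin n)

/-- `p ∈ L^∞_+(Ω)`: `p` is measurable and essentially bounded on `Ω`, and its essential infimum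
exceeds `1`. -/
def IsExponent {n : ℕ} (Ω : Set (Rn n)) (p : Rn n → ℝ) : Prop :=
  AEMeasurable p (volume.restrict Ω) ∧
    ∃ a b : ℝ, 1 < a ∧ ∀ᵐ x ∂(volume.restrict Ω), a ≤ p x ∧ p x ≤ b

/-- `f⁺`, the essential supremum of `f` over `Ω` (used for essentially bounded `f` only). -/
def supOn {n : ℕ} (Ω : Set (Rn n)) (f : Rn n → ℝ) : ℝ := essSup f (volume.restrict Ω)

/-- `f⁻`, the essential infimum of `f` over `Ω` (used for essentially bounded `f` only). -/
def infOn {n : ℕ} (Ω : Set (Rn n)) (f : Rn n → ℝ) : ℝ := essInf f (volume.restrict Ω)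

/-- `ϑ ∈ W_p(Ω)`: `ϑ` is locally integrable, positive almost everywhere, and `ϑ^{-1/(p-1)}` is
locally integrable. -/
structure IsWeight {n : ℕ} (Ω : Set (Rn n)) (p ϑ : Rn n → ℝ) : Prop where
  locInt : LocallyIntegrableOn ϑ Ω
  pos : ∀ᵐ x ∂(volume.restrict Ω), 0 < ϑ x
  locInt_dual : LocallyIntegrableOn (fun x => ϑ x ^ (-(1 / (p x - 1)))) Ω

/-- `f ∈ L^{p(·)}(S, ϑ)`: `f` is measurable and `∫_S |t f|^p ϑ dx < ∞` for some `t > 0`. -/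
def MemLVar {n : ℕ} {F : Type*} [NormedAddCommGroup F] (S : Set (Rn n)) (p ϑ : Rn n → ℝ)
    (f : Rn n → F) : Prop :=
  AEStronglyMeasurable f (volume.restrict S) ∧
    ∃ t : ℝ, 0 < t ∧ ∫⁻ x in S, ENNReal.ofReal ((t * ‖f x‖) ^ p x * ϑ x) < (⊤ : ℝ≥0∞)

/-- `g` is the weak (distributional) gradient of `f` on the open set `U`. -/
structure HasWeakGrad {n : ℕ} (U : Set (Rn n)) (f : Rn n → ℝ) (g : Rn n → Rn n) : Prop where
  locInt : LocallyIntegrableOn f U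
  locInt_grad : LocallyIntegrableOn g U
  parts : ∀ ψ : Rn n → ℝ, ContDiff ℝ ((⊤ : ℕ∞) : WithTop ℕ∞) ψ → HasCompactSupport ψ → tsupport ψ ⊆ U → ∀ i : Fin n,
    ∫ x in U, f x * fderiv ℝ ψ x (EuclideanSpace.single i 1) = -∫ x in U, g x i * ψ x

/-- `f ∈ W^{1,p(·)}(Ω, ϑ)` with gradient `g`. -/
structure MemW {n : ℕ} (Ω : Set (Rn n)) (p ϑ : Rn n → ℝ) (f : Rn n → ℝ) (g : Rn n → Rn n) :
    Prop where
  grad : HasWeakGrad Ω f g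
  mem : MemLVar Ω p ϑ f
  mem_grad : MemLVar Ω p ϑ g

/-- The extended-real function `u` belongs to `W^{1,p(·)}_loc(U, ϑ)` with gradient `g`: it is finite
almost everywhere, weakly differentiable on `U`, and `u`, `|∇u|` are in `L^{p(·)}(K, ϑ)` for
every compact `K ⊆ U`. -/
structure MemWLoc {n : ℕ} (U : Set (Rn n)) (p ϑ : Rn n → ℝ) (u : Rn n → EReal)
    (g : Rn n → Rn n) : Prop where
  finite : ∀ᵐ x ∂(volume.restrict U), u x ≠ ⊤ ∧ u x ≠ ⊥
  grad : HasWeakGrad U (fun x => (u x).toReal) g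
  mem : ∀ K : Set (Rn n), IsCompact K → K ⊆ U → MemLVar K p ϑ (fun x => (u x).toReal)
  mem_grad : ∀ K : Set (Rn n), IsCompact K → K ⊆ U → MemLVar K p ϑ g

/-- `f` has an integral over `S`, which may be `±∞`: it is measurable and at least one of
`∫_S f⁺`, `∫_S f⁻` is finite. -/
def HasIntegralOn {n : ℕ} (S : Set (Rn n)) (f : Rn n → EReal) : Prop :=
  AEMeasurable f (volume.restrict S) ∧
    (∫⁻ x in S, (f x).toENNReal < (⊤ : ℝ≥0∞) ∨ ∫⁻ x in S, (-f x).toENNReal < (⊤ : ℝ≥0∞))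

/-- `u ∈ W^{1,p(·)}_{E,loc}(Ω, ϑ)`; `g` is the gradient of `u` on `Ω \ E`, and `G` is the extension
of `g` to a function on `Ω` each of whose components has an integral. -/
structure MemWELoc {n : ℕ} (Ω E : Set (Rn n)) (p ϑ : Rn n → ℝ) (u : Rn n → EReal)
    (g : Rn n → Rn n) : Prop where
  integral : HasIntegralOn Ω u
  memLoc : MemWLoc (Ω \ E) p ϑ u g
  extension : ∃ G : Rn n → Fin n → EReal, (∀ i, HasIntegralOn Ω (fun x => G x i)) ∧
    ∀ᵐ x ∂(volume.restrict (Ω \ E)), ∀ i, G x i = ((g x i : ℝ) : EReal)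

/-- The inequality `∫_U ⟨A(x,u,∇u), ∇φ⟩ + B(x,u) φ dx ≤ 0` for all non-negative
`φ ∈ W^{1,p(·)}(Ω, ϑ)` with compact support in `U ⊆ Ω`; the integrals are finite. Here `∇u = g`. -/
def SubIneq {n : ℕ} (Ω U : Set (Rn n)) (p ϑ : Rn n → ℝ) (A : Rn n → ℝ → Rn n → Rn n)
    (B : Rn n → ℝ → ℝ) (u : Rn n → EReal) (g : Rn n → Rn n) : Prop :=
  ∀ (φ : Rn n → ℝ) (dφ : Rn n → Rn n), MemW Ω p ϑ φ dφ →
    (∀ᵐ x ∂(volume.restrict Ω), 0 ≤ φ x) →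
    (∃ K : Set (Rn n), IsCompact K ∧ K ⊆ U ∧ ∀ᵐ x ∂(volume.restrict Ω), x ∉ K → φ x = 0) →
    IntegrableOn
      (fun x => inner ℝ (A x (u x).toReal (g x)) (dφ x) + B x (u x).toReal * φ x) U ∧
    ∫ x in U, (inner ℝ (A x (u x).toReal (g x)) (dφ x) + B x (u x).toReal * φ x) ≤ 0

/-- `u ∈ W^{1,p(·)}_{E,loc}(Ω, ϑ)` is a weak sub-solution of `-div A(x,u,∇u) + B(x,u) = 0` in
`Ω \ E`. -/
def IsSubsolutionOff {n : ℕ} (Ω E : Set (Rn n)) (p ϑ : Rn n → ℝ) (A : Rn n → ℝ → Rn n → Rn n)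
    (B : Rn n → ℝ → ℝ) (u : Rn n → EReal) : Prop :=
  ∃ g : Rn n → Rn n, MemWELoc Ω E p ϑ u g ∧ SubIneq Ω (Ω \ E) p ϑ A B u g

/-- The singularity is removable: `u ∈ W^{1,p(·)}_loc(Ω, ϑ)`, and the sub-solution inequality holds
in all of `Ω`, for all non-negative `φ ∈ W^{1,p(·)}(Ω, ϑ)` with compact support in `Ω`. -/
def SingularityRemoved {n : ℕ} (Ω : Set (Rn n)) (p ϑ : Rn n → ℝ) (A : Rn n → ℝ → Rn n → Rn n)
    (B : Rn n → ℝ → ℝ) (u : Rn n → EReal) : Prop :=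
  ∃ g : Rn n → Rn n, MemWLoc Ω p ϑ u g ∧ SubIneq Ω Ω p ϑ A B u g

/-- The `(α, ϑ)`-upper Minkowski content of `F`, for `α`, `ϑ` given on `Ω`:
`limsup_{ε → 0⁺} ∫_{F_ε} ε^{α(x) - n} ϑ(x) dx`, with `F_ε` the open `ε`-neighbourhood of `F`
(the integrand lives on `Ω`; when `F` is a compact subset of `Ω`, `F_ε ⊆ Ω` for small `ε`). -/
def upperMinkowski {n : ℕ} (Ω : Set (Rn n)) (α ϑ : Rn n → ℝ) (F : Set (Rn n)) : ℝ≥0∞ :=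
  limsup (fun ε : ℝ => ∫⁻ x in Metric.thickening ε F ∩ Ω,
    ENNReal.ofReal (ε ^ (α x - (n : ℝ)) * ϑ x)) (𝓝[>] 0)

/-- Measurability of `A : Ω × [0,∞) × ℝⁿ → ℝⁿ` and `B : Ω × [0,∞) → ℝ`, Lebesgue in `x` and Borel in
the other variables: up to a null set of `x`, the functions are Borel measurable. -/
structure CoeffMeasurable {n : ℕ} (Ω : Set (Rn n)) (A : Rn n → ℝ → Rn n → Rn n)
    (B : Rn n → ℝ → ℝ) : Prop where
  measA : ∃ A' : Rn n × ℝ × Rn n → Rn n, Measurable A' ∧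
    ∀ᵐ x ∂(volume.restrict Ω), ∀ s : ℝ, 0 ≤ s → ∀ η : Rn n, A x s η = A' (x, s, η)
  measB : ∃ B' : Rn n × ℝ → ℝ, Measurable B' ∧
    ∀ᵐ x ∂(volume.restrict Ω), ∀ s : ℝ, 0 ≤ s → B x s = B' (x, s)

/-- The growth conditions on `A` and `B`. -/
structure GrowthConditions {n : ℕ} (Ω : Set (Rn n)) (p ϑ : Rn n → ℝ) (μ : ℝ)
    (a₁ a₂ a₃ : Rn n → ℝ) (A : Rn n → ℝ → Rn n → Rn n) (B : Rn n → ℝ → ℝ) : Prop where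
  coercive : ∀ᵐ x ∂(volume.restrict Ω), ∀ s : ℝ, 0 ≤ s → ∀ η : Rn n,
    (μ * ‖η‖ ^ p x - μ⁻¹ * s ^ p x + a₁ x) * ϑ x ≤ inner ℝ (A x s η) η
  boundA : ∀ᵐ x ∂(volume.restrict Ω), ∀ s : ℝ, 0 ≤ s → ∀ η : Rn n,
    ‖A x s η‖ ≤ (μ⁻¹ * ‖η‖ ^ (p x - 1) + μ⁻¹ * s ^ (p x - 1) + a₂ x) * ϑ x
  boundB : ∀ᵐ x ∂(volume.restrict Ω), ∀ s : ℝ, 0 ≤ s →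
    |B x s| ≤ (μ⁻¹ * s ^ (p x - 1) + a₃ x) * ϑ x

/-- A measurable function `Ω → [0, n]`. -/
def IsDimFun {n : ℕ} (Ω : Set (Rn n)) (α : Rn n → ℝ) : Prop :=
  AEMeasurable α (volume.restrict Ω) ∧
    ∀ᵐ x ∂(volume.restrict Ω), 0 ≤ α x ∧ α x ≤ (n : ℝ)

/-- The constraints on the exponents. -/
structure ExponentConditions {n : ℕ} (Ω : Set (Rn n)) (p q₁ q₂ q₃ α β : Rn n → ℝ) : Prop where
  beta_le : supOn Ω (fun x => p x * β x) ≤ (n : ℝ) - supOn Ω α - supOn Ω p - 1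
  q₁_ge : supOn Ω (fun x => p x / (p x - 1)) ≤ infOn Ω q₁
  q₃_ge : supOn Ω (fun x => p x / (p x - 1)) ≤ infOn Ω q₃
  q₂_ge : max (supOn Ω (fun x => p x / (p x - 1)))
    (((n : ℝ) - supOn Ω α) / ((n : ℝ) - supOn Ω α - supOn Ω β - 2)) ≤ infOn Ω q₂

end

/-! Everything rests on one decay statement. Put P = p⁺ and Q = (pβ)⁺. The exponent condition says n
- α⁺ ≥ P + Q + 1, so vanishing of the content forces ε^{-(P+Q+1)} ∫_{E_ε} ϑ → 0, where E_ε is the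
ε-neighbourhood of E. On the shell ε/4 < d(x,E) < ε the pointwise bound gives u^p + 1 ≤ const ·
ε^{-Q}, hence ε^{-P} ∫_shell (u^p + 1) ϑ → 0 (`tendsto_lintegral_shell`). The factor ε^{-P} is the
price of a cutoff ξ_ε that vanishes near E and has gradient of order 1/ε, so every error caused by
such a cutoff disappears as ε → 0. The same decay makes E a null set, and its spare power of ε makes
the dyadic shells summable, so that u^p ϑ is locally integrable up to E
(`locallyIntegrableOn_rpow_mul`).

Three applications follow, in the abstract setting `RemovableSetting`. Testing with χ^m u, where χ =
ζ ξ_ε and m ≥ P, gives a Caccioppoli bound independent of ε, hence |∇u|^p ϑ is locally integrable up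
to E (`integrableOn_grad`). Testing the weak gradient identity with ψ ξ_ε shows that ∇u is the weak
gradient across E; the error u ψ ∇ξ_ε is handled by Young's inequality and the dual weight
(`hasWeakGrad`). Testing the sub-solution inequality with ξ_ε T_k(φ), where T_k is a bounded C¹
truncation, leaves the error T_k(φ) ⟨A, ∇ξ_ε⟩, which vanishes because T_k(φ) is bounded; then k → ∞
by dominated convergence (`sub_across`).

The truncation needs a chain rule for weak gradients, `HasWeakGrad.comp_left`, which is obtained by
mollification. -/

/-! ### Gradients, and weak gradients of products with smooth functions. -/

theorem gradient_apply_eq_fderiv {n : ℕ} (η : Rn n → ℝ) (x : Rn n) (i : Fin n) :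
    gradient η x i = fderiv ℝ η x (EuclideanSpace.single i 1) := by
  rw [← inner_gradient_left, EuclideanSpace.inner_single_right]
  simp

theorem norm_gradient_eq_norm_fderiv {n : ℕ} (η : Rn n → ℝ) (x : Rn n) :
    ‖gradient η x‖ = ‖fderiv ℝ η x‖ := by
  simp [gradient]

theorem continuous_gradient {n : ℕ} {η : Rn n → ℝ}
    (hη : ContDiff ℝ ((⊤ : ℕ∞) : WithTop ℕ∞) η) : Continuous (gradient η) :=
  (InnerProductSpace.toDual ℝ (Rn n)).symm.continuous.comp (hη.continuous_fderiv (by simp))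

theorem gradient_eq_zero_of_notMem_tsupport {n : ℕ} {η : Rn n → ℝ} {x : Rn n}
    (hx : x ∉ tsupport η) : gradient η x = 0 := by
  have : fderiv ℝ η x = 0 := by
    have h := tsupport_fderiv_subset ℝ (f := η)
    by_contra h0
    exact hx (h (subset_tsupport _ h0))
  simp [gradient, this]

/-- A locally integrable function times a continuous function with compact support in `U`
is integrable. -/
theorem integrable_smul_of_tsupport_subset {n : ℕ} {F : Type*} [NormedAddCommGroup F]
    [NormedSpace ℝ F] {U : Set (Rn n)} {f : Rn n → F} (hf : LocallyIntegrableOn f U)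
    {c : Rn n → ℝ} (hc : Continuous c) (hcs : HasCompactSupport c) (hcU : tsupport c ⊆ U) :
    Integrable (fun x => c x • f x) := by
  rw [← integrableOn_iff_integrable_of_support_subset (s := tsupport c)]
  · exact (hf.integrableOn_compact_subset hcU hcs).continuousOn_smul hc.continuousOn hcs
  · intro x hx
    refine subset_tsupport c fun h => hx ?_
    simp [h]

/-- A point of `V` either lies in the support of `η`, hence in `U`, or has a neighbourhood on which
`f` vanishes. -/
theorem locallyIntegrableOn_of_tsupport {n : ℕ} {F : Type*} [NormedAddCommGroup F]
    {U V : Set (Rn n)} (hU : IsOpen U)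
    {f : Rn n → F} (hf : LocallyIntegrableOn f U) {η : Rn n → ℝ} (hs : V ∩ tsupport η ⊆ U)
    (h0 : ∀ x ∉ tsupport η, f x = 0) : LocallyIntegrableOn f V := by
  intro x hx
  by_cases hxη : x ∈ tsupport η
  · have hxU := hs ⟨hx, hxη⟩
    have := hf x hxU
    rw [hU.nhdsWithin_eq hxU] at this
    exact this.filter_mono nhdsWithin_le_nhds
  · refine ⟨(tsupport η)ᶜ, mem_nhdsWithin_of_mem_nhds
      ((isClosed_tsupport η).isOpen_compl.mem_nhds hxη), ?_⟩
    refine (integrableOn_zero (ε' := F)).congr_fun (fun y hy => (h0 y hy).symm) ?_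
    exact (isClosed_tsupport η).measurableSet.compl

/-- The product rule for a weakly differentiable function and a smooth function. The product is
weakly differentiable on any set in which the smooth factor is supported in `U`. -/
theorem HasWeakGrad.smooth_mul {n : ℕ} {U V : Set (Rn n)} (hU : IsOpen U) (hV : IsOpen V)
    (hUV : U ⊆ V) {f : Rn n → ℝ} {g : Rn n → Rn n} (h : HasWeakGrad U f g) {η : Rn n → ℝ}
    (hη : ContDiff ℝ ((⊤ : ℕ∞) : WithTop ℕ∞) η) (hs : V ∩ tsupport η ⊆ U) :
    HasWeakGrad V (fun x => η x * f x) (fun x => η x • g x + f x • gradient η x) := by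
  have hη0 : ∀ x ∉ tsupport η, η x = 0 := fun x hx => image_eq_zero_of_notMem_tsupport hx
  have hd0 : ∀ x ∉ tsupport η, gradient η x = 0 :=
    fun x hx => gradient_eq_zero_of_notMem_tsupport hx
  have hηc := hη.continuous
  refine ⟨?_, ?_, ?_⟩
  · refine locallyIntegrableOn_of_tsupport hU
      (h.locInt.continuousOn_mul hηc.continuousOn hU.isLocallyClosed) hs fun x hx => ?_
    simp [hη0 x hx]
  · refine locallyIntegrableOn_of_tsupport hU
      ((h.locInt_grad.continuousOn_smul hU.isLocallyClosed hηc.continuousOn).add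
      (h.locInt.smul_continuousOn hU.isLocallyClosed (continuous_gradient hη).continuousOn)) hs
      fun x hx => ?_
    simp [hη0 x hx, hd0 x hx]
  · intro ψ hψ hψc hψV i
    set e : Rn n := EuclideanSpace.single i 1
    -- The identity on `U` is tested with `η ψ`: its support lies in `U`, although that of `ψ` need
    -- only lie in `V`.
    have hst : tsupport (fun x => η x * ψ x) ⊆ U := by
      have h1 := tsupport_mul_subset_left (f := η) (g := ψ)
      have h2 := tsupport_mul_subset_right (f := η) (g := ψ)
      exact fun x hx => hs ⟨hψV (h2 hx), h1 hx⟩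
    have hcs : HasCompactSupport (fun x => η x * ψ x) := hψc.mul_left
    have key := h.parts (fun x => η x * ψ x) (hη.mul hψ) hcs hst i
    have hder : ∀ x, fderiv ℝ (fun x => η x * ψ x) x e
        = η x * fderiv ℝ ψ x e + ψ x * fderiv ℝ η x e := by
      intro x
      rw [fderiv_fun_mul (hη.differentiable (by simp) x) (hψ.differentiable (by simp) x)]
      simp
    have hVU : ∀ F : Rn n → ℝ, (∀ x ∉ tsupport η, F x = 0) → ∫ x in V, F x = ∫ x in U, F x := by
      intro F hF
      refine setIntegral_eq_of_subset_of_forall_sdiff_eq_zero hV.measurableSet hUV fun x hx => ?_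
      exact hF x fun hxη => hx.2 (hs ⟨hx.1, hxη⟩)
    have hfψ : Continuous fun x => fderiv ℝ ψ x e :=
      (hψ.continuous_fderiv (by simp)).clm_apply continuous_const
    have hfη : Continuous fun x => fderiv ℝ η x e :=
      (hη.continuous_fderiv (by simp)).clm_apply continuous_const
    have hsub : ∀ {a b : Rn n → ℝ}, tsupport a ⊆ tsupport η → tsupport b ⊆ tsupport ψ →
        tsupport (fun x => a x * b x) ⊆ U := by
      intro a b ha hb x hx
      exact hs ⟨hψV (hb ((tsupport_mul_subset_right (f := a) (g := b)) hx)),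
        ha ((tsupport_mul_subset_left (f := a) (g := b)) hx)⟩
    have htd : ∀ φ : Rn n → ℝ, tsupport (fun x => fderiv ℝ φ x e) ⊆ tsupport φ :=
      fun φ => tsupport_fderiv_apply_subset ℝ e
    have hcψ : HasCompactSupport fun x => fderiv ℝ ψ x e := hψc.fderiv_apply ℝ e
    have I1 : Integrable (fun x => (η x * fderiv ℝ ψ x e) • f x) :=
      integrable_smul_of_tsupport_subset h.locInt (hηc.mul hfψ) hcψ.mul_left
        (hsub subset_rfl (htd ψ))
    have I2 : Integrable (fun x => (fderiv ℝ η x e * ψ x) • f x) :=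
      integrable_smul_of_tsupport_subset h.locInt (hfη.mul hψ.continuous) hψc.mul_left
        (hsub (htd η) subset_rfl)
    have I3 : Integrable (fun x => (η x * ψ x) • g x) :=
      integrable_smul_of_tsupport_subset h.locInt_grad (hηc.mul hψ.continuous) hcs hst
    have I3' : Integrable (fun x => g x i * (η x * ψ x)) := by
      have := (EuclideanSpace.proj (𝕜 := ℝ) i).integrable_comp I3
      refine this.congr (Eventually.of_forall fun x => ?_)
      simp; ring
    rw [hVU _ (fun x hx => by simp [hη0 x hx]), hVU _ (fun x hx => by simp [hη0 x hx, hd0 x hx])]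
    have e1 : ∫ x in U, f x * fderiv ℝ (fun x => η x * ψ x) x e
        = (∫ x in U, η x * f x * fderiv ℝ ψ x e) + ∫ x in U, (fderiv ℝ η x e * ψ x) • f x := by
      rw [← integral_add]
      · congr 1; ext x; rw [hder]; simp only [smul_eq_mul]; ring
      · refine I1.integrableOn.congr (Eventually.of_forall fun x => ?_)
        simp only [smul_eq_mul]; ring
      · exact I2.integrableOn
    have e2 : ∫ x in U, (η x • g x + f x • gradient η x) i * ψ x
        = (∫ x in U, g x i * (η x * ψ x)) + ∫ x in U, (fderiv ℝ η x e * ψ x) • f x := by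
      rw [← integral_add I3'.integrableOn I2.integrableOn]
      congr 1; ext x
      simp only [PiLp.add_apply, PiLp.smul_apply, smul_eq_mul, gradient_apply_eq_fderiv]
      ring
    rw [e2]
    linarith [key, e1]

/-! ### Mollification in L¹, and the chain rule for integrable functions. -/

/-- Scheffé's lemma for non-negative functions of equal integral. -/
theorem tendsto_integral_abs_sub_of_integral_eq {X : Type*} [MeasurableSpace X] {ν : Measure X}
    {F : ℕ → X → ℝ} {f : X → ℝ} (hF : ∀ j, Integrable (F j) ν) (hf : Integrable f ν)
    (hF0 : ∀ j x, 0 ≤ F j x) (hint : ∀ j, ∫ x, F j x ∂ν = ∫ x, f x ∂ν)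
    (hlim : ∀ᵐ x ∂ν, Tendsto (fun j => F j x) atTop (𝓝 (f x))) :
    Tendsto (fun j => ∫ x, |F j x - f x| ∂ν) atTop (𝓝 0) := by
  have hpos : ∀ j, Integrable (fun x => max (f x - F j x) 0) ν :=
    fun j => (hf.sub (hF j)).pos_part
  have h1 : ∀ j, ∫ x, |F j x - f x| ∂ν = 2 * ∫ x, max (f x - F j x) 0 ∂ν := by
    intro j
    -- The last summand has integral zero, and the positive part of `f - F j` is dominated by `|f|`
    -- because `F j ≥ 0`.
    have : ∀ x, |F j x - f x| = 2 * max (f x - F j x) 0 + (F j x - f x) := by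
      intro x
      rcases le_total (F j x) (f x) with h | h
      · rw [abs_of_nonpos (by linarith), max_eq_left (by linarith)]; ring
      · rw [abs_of_nonneg (by linarith), max_eq_right (by linarith)]; ring
    simp_rw [this]
    have e1 := integral_add ((hpos j).const_mul 2) ((hF j).sub hf)
    simp only [Pi.sub_apply] at e1
    rw [e1, integral_sub (hF j) hf, hint, integral_const_mul]
    ring
  simp_rw [h1]
  have h2 : Tendsto (fun j => ∫ x, max (f x - F j x) 0 ∂ν) atTop (𝓝 (∫ _, (0 : ℝ) ∂ν)) := by
    refine tendsto_integral_of_dominated_convergence (fun x => |f x|)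
      (fun j => (hpos j).aestronglyMeasurable) hf.abs (fun j => Eventually.of_forall fun x => ?_) ?_
    · rw [Real.norm_of_nonneg (le_max_right _ _)]
      exact max_le (by linarith [hF0 j x, le_abs_self (f x)]) (abs_nonneg _)
    · filter_upwards [hlim] with x hx
      have := (hx.const_sub (f x)).max (tendsto_const_nhds (x := (0 : ℝ)))
      simpa using this
  simpa using h2.const_mul 2

section Mollification

open ContinuousLinearMap
open scoped Convolution

variable {n : ℕ}

theorem integrable_normed_convolution (φ : ContDiffBump (0 : Rn n)) {g : Rn n → ℝ}
    (hg : Integrable g) : Integrable (φ.normed volume ⋆[lsmul ℝ ℝ, volume] g) :=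
  φ.integrable_normed.integrable_convolution _ hg

/-- Mollification preserves the integral and converges almost everywhere (this is where the
comparable radii enter), so Scheffé's lemma settles non-negative functions; the general case splits
into positive and negative parts. -/
theorem tendsto_integral_abs_convolution_sub {φ : ℕ → ContDiffBump (0 : Rn n)}
    (hφ : Tendsto (fun j => (φ j).rOut) atTop (𝓝 0)) (hφ' : ∀ j, (φ j).rOut ≤ 2 * (φ j).rIn)
    {g : Rn n → ℝ} (hg : Integrable g) :
    Tendsto (fun j => ∫ x, |((φ j).normed volume ⋆[lsmul ℝ ℝ, volume] g) x - g x|)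
      atTop (𝓝 0) := by
  have key : ∀ h : Rn n → ℝ, Integrable h → (∀ x, 0 ≤ h x) →
      Tendsto (fun j => ∫ x, |((φ j).normed volume ⋆[lsmul ℝ ℝ, volume] h) x - h x|)
        atTop (𝓝 0) := by
    intro h hh h0
    refine tendsto_integral_abs_sub_of_integral_eq (fun j => integrable_normed_convolution _ hh) hh
      (fun j x => integral_nonneg fun t => ?_) (fun j => ?_)
      (ContDiffBump.ae_convolution_tendsto_right_of_locallyIntegrable hφ
        (Eventually.of_forall hφ') hh.locallyIntegrable)
    · exact mul_nonneg ((φ j).nonneg_normed _) (h0 _)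
    · rw [integral_convolution _ (φ j).integrable_normed hh, (φ j).integral_normed]
      simp
  have hp := key _ hg.pos_part fun x => le_max_right _ _
  have hm := key _ hg.neg_part fun x => le_max_right _ _
  refine squeeze_zero (fun j => integral_nonneg fun x => abs_nonneg _) (fun j => ?_)
    (by simpa using hp.add hm)
  have Ip := (integrable_normed_convolution (φ j) hg.pos_part).sub hg.pos_part
  have Im := (integrable_normed_convolution (φ j) hg.neg_part).sub hg.neg_part
  refine le_of_le_of_eq ?_ (integral_add Ip.abs Im.abs)
  refine integral_mono ((integrable_normed_convolution (φ j) hg).sub hg).abs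
    (Ip.abs.add Im.abs) fun x => ?_
  have hex : ∀ {k : Rn n → ℝ}, Integrable k →
      ConvolutionExistsAt ((φ j).normed volume) k x (lsmul ℝ ℝ) volume := fun hk =>
    (φ j).hasCompactSupport_normed.convolutionExists_left _ (φ j).continuous_normed
      hk.locallyIntegrable x
  have hadd := (hex hg).distrib_add (hex hg.neg_part)
  have hsum : (g + fun a => max (-g a) 0) = fun a => max (g a) 0 := by
    ext a
    rcases le_total 0 (g a) with h | h
    · simp [h]
    · simp [h]
  rw [hsum] at hadd
  have hx : g x = max (g x) 0 - max (-g x) 0 := by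
    rcases le_total 0 (g x) with h | h
    · simp [h]
    · simp [h]
  set P := ((φ j).normed volume ⋆[lsmul ℝ ℝ, volume] fun a => max (g a) 0) x
  set M := ((φ j).normed volume ⋆[lsmul ℝ ℝ, volume] fun a => max (-g a) 0) x
  set G := ((φ j).normed volume ⋆[lsmul ℝ ℝ, volume] g) x
  have : G - g x = (P - max (g x) 0) - (M - max (-g x) 0) := by rw [hadd]; linarith
  change |G - g x| ≤ |P - max (g x) 0| + |M - max (-g x) 0|
  rw [this]
  exact abs_sub _ _

/-- Mollification commutes with weak differentiation. -/
theorem fderiv_convolution_of_weak {ρ : Rn n → ℝ} (hρ : ContDiff ℝ ((⊤ : ℕ∞) : WithTop ℕ∞) ρ)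
    (hρc : HasCompactSupport ρ) {f g : Rn n → ℝ} (hf : Integrable f) {e : Rn n}
    (hparts : ∀ ψ : Rn n → ℝ, ContDiff ℝ ((⊤ : ℕ∞) : WithTop ℕ∞) ψ → HasCompactSupport ψ →
      ∫ x, f x * fderiv ℝ ψ x e = -∫ x, g x * ψ x) (x : Rn n) :
    fderiv ℝ (ρ ⋆[lsmul ℝ ℝ, volume] f) x e = (ρ ⋆[lsmul ℝ ℝ, volume] g) x := by
  have hρ1 : ContDiff ℝ 1 ρ := hρ.of_le (by exact_mod_cast le_top)
  rw [(hρc.hasFDerivAt_convolution_left (lsmul ℝ ℝ) hρ1 hf.locallyIntegrable x).fderiv]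
  have hex : ConvolutionExistsAt (fderiv ℝ ρ) f x ((lsmul ℝ ℝ).precompL (Rn n)) volume :=
    (hρc.fderiv ℝ).convolutionExists_left _ (hρ.continuous_fderiv (by simp))
      hf.locallyIntegrable x
  rw [convolution_def, ContinuousLinearMap.integral_apply hex]
  rw [convolution_eq_swap]
  -- The test function is the reflected and translated kernel; the sign from the reflection cancels
  -- the one in the weak identity.
  have hψ : ContDiff ℝ ((⊤ : ℕ∞) : WithTop ℕ∞) (fun y => ρ (x - y)) :=
    hρ.comp (contDiff_const.sub contDiff_id)
  have hψc : HasCompactSupport (fun y => ρ (x - y)) :=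
    hρc.comp_homeomorph (Homeomorph.subLeft x)
  have hd : ∀ y, fderiv ℝ (fun y => ρ (x - y)) y e = -fderiv ℝ ρ (x - y) e := by
    intro y
    have h1 : HasFDerivAt (fun y : Rn n => x - y) (-ContinuousLinearMap.id ℝ (Rn n)) y :=
      (hasFDerivAt_id y).const_sub x
    have h2 := ((hρ.differentiable (by simp) (x - y)).hasFDerivAt.comp y h1).fderiv
    have h3 : fderiv ℝ (fun y => ρ (x - y)) y = fderiv ℝ (ρ ∘ fun y => x - y) y := rfl
    rw [h3, h2]
    simp
  have key := hparts _ hψ hψc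
  simp_rw [hd] at key
  rw [← integral_sub_left_eq_self _ volume x]
  simp only [precompL_apply, lsmul_apply, smul_eq_mul, sub_sub_cancel]
  rw [show (∫ t, ρ (x - t) * g t) = ∫ t, g t * ρ (x - t) from by simp_rw [mul_comm]]
  rw [show (∫ t, (fderiv ℝ ρ (x - t)) e * f t) = -∫ t, f t * -(fderiv ℝ ρ (x - t)) e from by
    rw [← integral_neg]; congr 1; ext t; ring]
  linarith

/-- For the mollified functions this is classical integration by parts. In the limit the product
T'(F_j) G_j is treated one factor at a time: G_j → g in L¹ against a bounded factor, then T'(F_j) →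
T'(f) almost everywhere with majorant a multiple of |g|. -/
theorem integral_comp_mul_fderiv_of_weak {f g : Rn n → ℝ} (hf : Integrable f) (hg : Integrable g)
    {e : Rn n}
    (hparts : ∀ ψ : Rn n → ℝ, ContDiff ℝ ((⊤ : ℕ∞) : WithTop ℕ∞) ψ → HasCompactSupport ψ →
      ∫ x, f x * fderiv ℝ ψ x e = -∫ x, g x * ψ x)
    {T : ℝ → ℝ} (hT : ContDiff ℝ 1 T) {M L : ℝ} (hM : ∀ s, |T s| ≤ M) (hL : ∀ s, |deriv T s| ≤ L)
    {ψ : Rn n → ℝ} (hψ : ContDiff ℝ ((⊤ : ℕ∞) : WithTop ℕ∞) ψ) (hψc : HasCompactSupport ψ) :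
    ∫ x, T (f x) * fderiv ℝ ψ x e = -∫ x, deriv T (f x) * g x * ψ x := by
  let φ : ℕ → ContDiffBump (0 : Rn n) := fun j =>
    ⟨1 / ((j : ℝ) + 1) / 2, 1 / ((j : ℝ) + 1), by positivity,
      half_lt_self (by positivity)⟩
  have hφ : Tendsto (fun j => (φ j).rOut) atTop (𝓝 0) := tendsto_one_div_add_atTop_nhds_zero_nat
  have hφ' : ∀ j, (φ j).rOut ≤ 2 * (φ j).rIn := fun j => by
    change 1 / ((j : ℝ) + 1) ≤ 2 * (1 / ((j : ℝ) + 1) / 2); linarith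
  have hfl := ContDiffBump.ae_convolution_tendsto_right_of_locallyIntegrable hφ
    (Eventually.of_forall hφ') hf.locallyIntegrable
  have hgl := tendsto_integral_abs_convolution_sub hφ hφ' hg
  set F : ℕ → Rn n → ℝ := fun j => (φ j).normed volume ⋆[lsmul ℝ ℝ, volume] f with hFdef
  set G : ℕ → Rn n → ℝ := fun j => (φ j).normed volume ⋆[lsmul ℝ ℝ, volume] g with hGdef
  have hGi : ∀ j, Integrable (G j) := fun j => integrable_normed_convolution _ hg
  have hFs : ∀ j, ContDiff ℝ 1 (F j) := fun j =>
    (φ j).hasCompactSupport_normed.contDiff_convolution_left (n := 1) _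
      (φ j).contDiff_normed hf.locallyIntegrable
  have hFG : ∀ j x, fderiv ℝ (F j) x e = G j x := fun j x =>
    fderiv_convolution_of_weak (φ j).contDiff_normed (φ j).hasCompactSupport_normed hf hparts x
  have hT' : Continuous (deriv T) := hT.continuous_deriv (by simp)
  have hψ' : Continuous fun x => fderiv ℝ ψ x e :=
    (hψ.continuous_fderiv (by simp)).clm_apply continuous_const
  have hψ'i : Integrable fun x => fderiv ℝ ψ x e :=
    hψ'.integrable_of_hasCompactSupport (hψc.fderiv_apply ℝ e)
  have hψi : Integrable ψ := hψ.continuous.integrable_of_hasCompactSupport hψc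
  obtain ⟨S, hS⟩ := hψ.continuous.bounded_above_of_compact_support hψc
  have hS0 : 0 ≤ S := (norm_nonneg _).trans (hS 0)
  have hL0 : 0 ≤ L := (abs_nonneg _).trans (hL 0)
  have hbd : ∀ (k h : Rn n → ℝ), AEStronglyMeasurable k volume → Integrable h →
      Integrable (fun x => deriv T (k x) * h x * ψ x) := by
    intro k h hk hh
    have h1 : Integrable fun x => (deriv T (k x) * ψ x) * h x := by
      refine hh.bdd_mul (c := L * S) ((hT'.comp_aestronglyMeasurable hk).mul
        hψ.continuous.aestronglyMeasurable) (Eventually.of_forall fun x => ?_)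
      rw [norm_mul]
      exact mul_le_mul (hL _) (hS x) (norm_nonneg _) hL0
    exact h1.congr (Eventually.of_forall fun x => by ring)
  have hTb : ∀ (k : Rn n → ℝ) (h : Rn n → ℝ), AEStronglyMeasurable k volume → Integrable h →
      Integrable (fun x => T (k x) * h x) := fun k h hk hh =>
    hh.bdd_mul (c := M) (hT.continuous.comp_aestronglyMeasurable hk)
      (Eventually.of_forall fun x => hM _)
  have hFm : ∀ j, AEStronglyMeasurable (F j) volume :=
    fun j => (hFs j).continuous.aestronglyMeasurable
  have hder : ∀ j x, fderiv ℝ (fun x => T (F j x)) x e = deriv T (F j x) * G j x := by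
    intro j x
    have h1 := (hT.differentiable (by simp) (F j x)).hasDerivAt.comp_hasFDerivAt x
      ((hFs j).differentiable (by simp) x).hasFDerivAt
    have h2 := h1.fderiv
    rw [show (fun x => T (F j x)) = T ∘ F j from rfl, h2]
    simp [hFG]
  have hj : ∀ j, ∫ x, T (F j x) * fderiv ℝ ψ x e = -∫ x, deriv T (F j x) * G j x * ψ x := by
    intro j
    have := integral_mul_fderiv_eq_neg_fderiv_mul_of_integrable (μ := (volume : Measure (Rn n)))
      (f := fun x => T (F j x)) (g := ψ) (v := e)
      (by simp_rw [hder]; exact hbd _ _ (hFm j) (hGi j)) (hTb _ _ (hFm j) hψ'i)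
      (hTb _ _ (hFm j) hψi)
      (fun x _ => (hT.comp (hFs j)).differentiable (by simp) x)
      (fun x _ => hψ.differentiable (by simp) x)
    simp_rw [hder] at this
    exact this
  have lim1 : Tendsto (fun j => ∫ x, T (F j x) * fderiv ℝ ψ x e) atTop
      (𝓝 (∫ x, T (f x) * fderiv ℝ ψ x e)) := by
    refine tendsto_integral_of_dominated_convergence (fun x => M * |fderiv ℝ ψ x e|)
      (fun j => (hTb _ _ (hFm j) hψ'i).aestronglyMeasurable) (hψ'i.abs.const_mul M)
      (fun j => Eventually.of_forall fun x => ?_) ?_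
    · rw [norm_mul]
      exact mul_le_mul_of_nonneg_right (hM _) (norm_nonneg _)
    · filter_upwards [hfl] with x hx
      exact ((hT.continuous.tendsto _).comp hx).mul_const _
  have lim2 : Tendsto (fun j => ∫ x, deriv T (F j x) * g x * ψ x) atTop
      (𝓝 (∫ x, deriv T (f x) * g x * ψ x)) := by
    refine tendsto_integral_of_dominated_convergence (fun x => L * |g x| * S)
      (fun j => (hbd _ _ (hFm j) hg).aestronglyMeasurable) ((hg.abs.const_mul L).mul_const S)
      (fun j => Eventually.of_forall fun x => ?_) ?_
    · rw [norm_mul, norm_mul]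
      exact mul_le_mul (mul_le_mul_of_nonneg_right (hL _) (norm_nonneg _)) (hS x) (norm_nonneg _)
        (mul_nonneg hL0 (abs_nonneg _))
    · filter_upwards [hfl] with x hx
      exact (((hT'.tendsto _).comp hx).mul_const _).mul_const _
  have lim3 : Tendsto (fun j => (∫ x, deriv T (F j x) * G j x * ψ x)
      - ∫ x, deriv T (F j x) * g x * ψ x) atTop (𝓝 0) := by
    refine squeeze_zero_norm (a := fun j => L * S * ∫ x, |G j x - g x|) (fun j => ?_)
      (by simpa using hgl.const_mul (L * S))
    rw [← integral_sub (hbd _ _ (hFm j) (hGi j)) (hbd _ _ (hFm j) hg), ← integral_const_mul]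
    refine norm_integral_le_of_norm_le ((((hGi j).sub hg).abs).const_mul _)
      (Eventually.of_forall fun x => ?_)
    have : deriv T (F j x) * G j x * ψ x - deriv T (F j x) * g x * ψ x
        = (deriv T (F j x) * ψ x) * (G j x - g x) := by ring
    rw [this, norm_mul, norm_mul]
    exact mul_le_mul_of_nonneg_right (mul_le_mul (hL _) (hS x) (norm_nonneg _) hL0)
      (norm_nonneg _)
  have lim4 := (lim3.add lim2).neg
  simp only [sub_add_cancel, zero_add] at lim4
  refine tendsto_nhds_unique lim1 (lim4.congr fun j => (hj j).symm)

end Mollification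

/-! ### Localisation and the chain rule for weak gradients. -/

/-- A smooth cutoff function, equal to one near `K` and supported in `U`. -/
theorem exists_smooth_cutoff {n : ℕ} {K U : Set (Rn n)} (hK : IsCompact K) (hU : IsOpen U)
    (hKU : K ⊆ U) : ∃ χ : Rn n → ℝ, ContDiff ℝ ((⊤ : ℕ∞) : WithTop ℕ∞) χ ∧ HasCompactSupport χ ∧
      tsupport χ ⊆ U ∧ (∀ x, χ x ∈ Set.Icc (0 : ℝ) 1) ∧ ∀ᶠ x in 𝓝ˢ K, χ x = 1 := by
  obtain ⟨L, hL, hKL, hLU⟩ := exists_compact_between hK hU hKU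
  obtain ⟨f, hf0, hf1, hf⟩ := exists_contMDiffMap_zero_one_nhds_of_isClosed (n := (⊤ : ℕ∞))
    (modelWithCornersSelf ℝ (Rn n)) (s := (interior L)ᶜ) (t := K) isOpen_interior.isClosed_compl
    hK.isClosed (Set.disjoint_left.2 fun x hx hxK => hx (hKL hxK))
  have hsupp : tsupport f ⊆ L := by
    refine closure_minimal (fun x hx => ?_) hL.isClosed
    by_contra hxL
    exact hx (hf0.self_of_nhdsSet x fun h => hxL (interior_subset h))
  exact ⟨f, f.contMDiff.contDiff, hL.of_isClosed_subset (isClosed_tsupport _) hsupp,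
    hsupp.trans hLU, hf, hf1⟩

theorem locallyIntegrableOn_of_norm_le {n : ℕ} {F G : Type*} [NormedAddCommGroup F]
    [NormedAddCommGroup G] {U : Set (Rn n)} (hU : IsOpen U) {f : Rn n → F} {g : Rn n → G}
    (hf : LocallyIntegrableOn f U) (hg : AEStronglyMeasurable g (volume.restrict U))
    (h : ∀ᵐ x ∂(volume.restrict U), ‖g x‖ ≤ ‖f x‖) : LocallyIntegrableOn g U := by
  rw [locallyIntegrableOn_iff hU.isLocallyClosed] at hf ⊢
  exact fun K hKU hK => Integrable.mono (hf K hKU hK) (hg.mono_measure (Measure.restrict_mono_set _ hKU))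
    (ae_restrict_of_ae_restrict_of_subset hKU h)

/-- The chain rule for a weakly differentiable function and a bounded `C¹` function with bounded
derivative. -/
theorem HasWeakGrad.comp_left {n : ℕ} {U : Set (Rn n)} (hU : IsOpen U) {f : Rn n → ℝ}
    {g : Rn n → Rn n} (h : HasWeakGrad U f g) {T : ℝ → ℝ} (hT : ContDiff ℝ 1 T) {M L : ℝ}
    (hM : ∀ s, |T s| ≤ M) (hL : ∀ s, |deriv T s| ≤ L) :
    HasWeakGrad U (fun x => T (f x)) (fun x => deriv T (f x) • g x) := by
  have hT' : Continuous (deriv T) := hT.continuous_deriv (by simp)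
  have hfm := h.locInt.aestronglyMeasurable
  refine ⟨?_, ?_, ?_⟩
  · refine locallyIntegrableOn_of_norm_le hU (locallyIntegrableOn_const M) (hT.continuous.comp_aestronglyMeasurable hfm)
      (Eventually.of_forall fun x => ?_)
    exact (hM _).trans (le_abs_self M)
  · refine locallyIntegrableOn_of_norm_le hU (h.locInt_grad.smul L) ((hT'.comp_aestronglyMeasurable hfm).smul
      h.locInt_grad.aestronglyMeasurable) (Eventually.of_forall fun x => ?_)
    simp only [Pi.smul_apply, norm_smul]
    exact mul_le_mul_of_nonneg_right ((hL _).trans (le_abs_self L)) (norm_nonneg _)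
  · intro ψ hψ hψc hψU i
    set e : Rn n := EuclideanSpace.single i 1
    -- The mollification argument needs integrable functions on the whole space. The product `χ f`
    -- is one, and near the support of `ψ`, where `χ = 1`, it has the same gradient as `f`.
    obtain ⟨χ, hχ, hχc, hχU, -, hχ1⟩ := exists_smooth_cutoff (K := tsupport ψ) hψc hU hψU
    have h2 := h.smooth_mul hU isOpen_univ (Set.subset_univ U) hχ (by simpa using hχU)
    have i1 : Integrable fun x => χ x * f x :=
      integrable_smul_of_tsupport_subset h.locInt hχ.continuous hχc hχU
    have i2 : Integrable fun x => χ x • g x + f x • gradient χ x := by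
      refine (integrable_smul_of_tsupport_subset h.locInt_grad hχ.continuous hχc hχU).add ?_
      rw [← integrableOn_iff_integrable_of_support_subset (s := tsupport χ)]
      · exact (h.locInt.integrableOn_compact_subset hχU hχc).smul_continuousOn
          (continuous_gradient hχ).continuousOn hχc
      · intro x hx
        by_contra hx'
        exact hx (by simp [gradient_eq_zero_of_notMem_tsupport hx'])
    have i3 : Integrable fun x => (χ x • g x + f x • gradient χ x) i :=
      (EuclideanSpace.proj (𝕜 := ℝ) i).integrable_comp i2
    have key := integral_comp_mul_fderiv_of_weak i1 i3 (e := e) (fun ψ' hψ' hψc' => by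
      have := h2.parts ψ' hψ' hψc' (Set.subset_univ _) i
      simpa only [setIntegral_univ] using this) hT hM hL hψ hψc
    have hψ0 : ∀ x ∉ tsupport ψ, ψ x = 0 := fun x hx => image_eq_zero_of_notMem_tsupport hx
    have hψd0 : ∀ x ∉ tsupport ψ, fderiv ℝ ψ x e = 0 := fun x hx => by
      rw [← gradient_apply_eq_fderiv, gradient_eq_zero_of_notMem_tsupport hx]; rfl
    have hχe : ∀ x ∈ tsupport ψ, χ x = 1 ∧ gradient χ x = 0 := by
      intro x hx
      have h1 : χ =ᶠ[𝓝 x] fun _ => 1 := hχ1.filter_mono (nhds_le_nhdsSet hx)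
      refine ⟨h1.self_of_nhds, ?_⟩
      have := h1.fderiv_eq (𝕜 := ℝ)
      simp [gradient, this]
    rw [setIntegral_eq_integral_of_forall_compl_eq_zero (fun x hx => by
        rw [hψd0 x fun hx' => hx (hψU hx'), mul_zero]),
      setIntegral_eq_integral_of_forall_compl_eq_zero (fun x hx => by
        rw [hψ0 x fun hx' => hx (hψU hx'), mul_zero])]
    convert key using 3
    · rename_i x
      by_cases hx : x ∈ tsupport ψ
      · simp [(hχe x hx).1]
      · simp [hψd0 x hx]
    · ext x
      by_cases hx : x ∈ tsupport ψ
      · simp [(hχe x hx).1, (hχe x hx).2]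
      · simp [hψ0 x hx]

/-- The weak gradient vanishes where the function does, on open sets. -/
theorem HasWeakGrad.ae_grad_eq_zero {n : ℕ} {U V : Set (Rn n)} (hV : IsOpen V) (hVU : V ⊆ U)
    {f : Rn n → ℝ} {g : Rn n → Rn n} (h : HasWeakGrad U f g) (hf : ∀ᵐ x, x ∈ V → f x = 0) :
    ∀ᵐ x, x ∈ V → g x = 0 := by
  refine hV.ae_eq_zero_of_integral_contDiff_smul_eq_zero (h.locInt_grad.mono_set hVU)
    fun ψ hψ hψc hψV => ?_
  have I := integrable_smul_of_tsupport_subset h.locInt_grad hψ.continuous hψc (hψV.trans hVU)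
  ext i
  have e1 := (EuclideanSpace.proj (𝕜 := ℝ) i).integral_comp_comm I
  have e2 := h.parts ψ hψ hψc (hψV.trans hVU) i
  have hz : ∫ x in U, f x * fderiv ℝ ψ x (EuclideanSpace.single i 1) = 0 := by
    refine integral_eq_zero_of_ae (ae_restrict_of_ae ?_)
    filter_upwards [hf] with x hx
    by_cases hxV : x ∈ V
    · simp [hx hxV]
    · rw [← gradient_apply_eq_fderiv,
        gradient_eq_zero_of_notMem_tsupport fun hx' => hxV (hψV hx')]
      simp
  rw [hz, setIntegral_eq_integral_of_forall_compl_eq_zero (fun x hx => by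
    rw [image_eq_zero_of_notMem_tsupport (f := ψ) fun hx' => hx (hVU (hψV hx')), mul_zero])] at e2
  refine e1.symm.trans ?_
  change ∫ x, ψ x * g x i = 0
  simp_rw [mul_comm (ψ _)]
  simpa using e2.symm

/-! ### Cutoff functions built from the distance to a set. -/

-- Convolution with a kernel of mass one averages translates of `f`, so the Lipschitz constant
-- survives; a kernel supported within radius `δ` moves the values by at most `δ`.
open ContinuousLinearMap in
open scoped Convolution in
theorem LipschitzWith.exists_smooth_approx {n : ℕ} {f : Rn n → ℝ} (hf : LipschitzWith 1 f) {δ : ℝ}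
    (hδ : 0 < δ) : ∃ g : Rn n → ℝ, ContDiff ℝ ((⊤ : ℕ∞) : WithTop ℕ∞) g ∧ LipschitzWith 1 g ∧
      ∀ x, |g x - f x| ≤ δ := by
  let φ : ContDiffBump (0 : Rn n) := ⟨δ / 2, δ, by positivity, half_lt_self hδ⟩
  have hfl : LocallyIntegrable f volume := hf.continuous.locallyIntegrable
  refine ⟨φ.normed volume ⋆[lsmul ℝ ℝ, volume] f,
    φ.hasCompactSupport_normed.contDiff_convolution_left _ φ.contDiff_normed hfl,
    LipschitzWith.of_dist_le_mul ?_, fun x => ?_⟩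
  · intro x y
    have hex : ∀ z, ConvolutionExistsAt (φ.normed volume) f z (lsmul ℝ ℝ) volume := fun z =>
      φ.hasCompactSupport_normed.convolutionExists_left _ φ.continuous_normed hfl z
    rw [Real.dist_eq, convolution_def, convolution_def, ← integral_sub (hex x) (hex y)]
    have h1 : ∫ t, φ.normed volume t * dist x y = ((1 : NNReal) : ℝ) * dist x y := by
      rw [integral_mul_const, φ.integral_normed, NNReal.coe_one]
    rw [← h1, ← Real.norm_eq_abs]
    refine norm_integral_le_of_norm_le ((φ.integrable_normed (μ := volume)).mul_const _)
      (Eventually.of_forall fun t => ?_)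
    simp only [lsmul_apply, smul_eq_mul]
    rw [← mul_sub, norm_mul, Real.norm_of_nonneg (φ.nonneg_normed _)]
    refine mul_le_mul_of_nonneg_left ?_ (φ.nonneg_normed _)
    have := hf.dist_le_mul (x - t) (y - t)
    simpa [Real.dist_eq] using this
  · rw [← Real.dist_eq]
    refine φ.dist_normed_convolution_le hf.continuous.aestronglyMeasurable fun y hy => ?_
    have := hf.dist_le_mul y x
    simp only [NNReal.coe_one, one_mul] at this
    exact this.trans (Metric.mem_ball.1 hy).le

/-- The derivative is continuous, hence bounded on [0,1], and the function is locally constant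
elsewhere. -/
theorem Real.smoothTransition.exists_deriv_bound :
    ∃ c : ℝ, 0 ≤ c ∧ ∀ t, |deriv Real.smoothTransition t| ≤ c := by
  have hc : Continuous (deriv Real.smoothTransition) :=
    (Real.smoothTransition.contDiff (n := 1)).continuous_deriv (by simp)
  obtain ⟨c, hc'⟩ := (isCompact_Icc (a := (0 : ℝ)) (b := 1)).exists_bound_of_continuousOn
    hc.continuousOn
  refine ⟨c, (norm_nonneg _).trans (hc' 0 (by simp)), fun t => ?_⟩
  by_cases ht : t ∈ Set.Icc (0 : ℝ) 1
  · exact hc' t ht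
  · have hz : deriv Real.smoothTransition t = 0 := by
      rcases lt_or_ge t 0 with h | h
      · have : Real.smoothTransition =ᶠ[𝓝 t] fun _ => 0 :=
          (eventually_lt_nhds h).mono fun s hs => Real.smoothTransition.zero_of_nonpos hs.le
        simpa using this.deriv_eq
      · have h1 : 1 < t := by
          by_contra h1
          exact ht ⟨h, not_lt.1 h1⟩
        have : Real.smoothTransition =ᶠ[𝓝 t] fun _ => 1 :=
          (eventually_gt_nhds h1).mono fun s hs => Real.smoothTransition.one_of_one_le hs.le
        simpa using this.deriv_eq
    rw [hz, abs_zero]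
    exact (norm_nonneg _).trans (hc' 0 (by simp))

/-- Smooth functions vanishing near `E`, equal to one at distance `ε`, with gradient of
order `1 / ε`. -/
theorem exists_smooth_cutoff_infDist (n : ℕ) : ∃ c : ℝ, 0 ≤ c ∧ ∀ (E : Set (Rn n)) (ε : ℝ), 0 < ε →
    ∃ ξ : Rn n → ℝ, ContDiff ℝ ((⊤ : ℕ∞) : WithTop ℕ∞) ξ ∧ (∀ x, ξ x ∈ Set.Icc (0 : ℝ) 1) ∧
      (∀ x, Metric.infDist x E ≤ ε / 4 → ξ x = 0 ∧ gradient ξ x = 0) ∧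
      (∀ x, ε ≤ Metric.infDist x E → ξ x = 1 ∧ gradient ξ x = 0) ∧
      ∀ x, ‖gradient ξ x‖ ≤ c / ε := by
  obtain ⟨c, hc0, hc⟩ := Real.smoothTransition.exists_deriv_bound
  refine ⟨4 * c, by positivity, fun E ε hε => ?_⟩
  obtain ⟨g, hg, hgl, hgd⟩ := (Metric.lipschitz_infDist_pt E).exists_smooth_approx
    (δ := ε / 8) (by positivity)
  -- As `g` is within `ε / 8` of the distance, `h ≤ 0` where the distance is at most `3ε/8` and `h ≥
  -- 1` where it is at least `7ε/8`. The slack towards `ε / 4` and `ε` makes the gradient vanish on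
  -- the closed regions of the claim.
  set h : Rn n → ℝ := fun x => 4 / ε * (g x - ε / 2) with hh
  have hhs : ContDiff ℝ ((⊤ : ℕ∞) : WithTop ℕ∞) h := contDiff_const.mul (hg.sub contDiff_const)
  have hone : ∀ x, 7 * ε / 8 ≤ Metric.infDist x E → Real.smoothTransition (h x) = 1 := by
    intro x hx
    refine Real.smoothTransition.one_of_one_le ?_
    have := (abs_le.1 (hgd x)).1
    have h2 : ε / 4 ≤ g x - ε / 2 := by linarith
    calc (1 : ℝ) = 4 / ε * (ε / 4) := by field_simp
      _ ≤ _ := mul_le_mul_of_nonneg_left h2 (by positivity)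
  have hzero : ∀ x, Metric.infDist x E ≤ 3 * ε / 8 → Real.smoothTransition (h x) = 0 := by
    intro x hx
    refine Real.smoothTransition.zero_of_nonpos ?_
    have := (abs_le.1 (hgd x)).2
    exact mul_nonpos_of_nonneg_of_nonpos (by positivity) (by linarith)
  refine ⟨fun x => Real.smoothTransition (h x), Real.smoothTransition.contDiff.comp hhs,
    fun x => ⟨Real.smoothTransition.nonneg _, Real.smoothTransition.le_one _⟩,
    fun x hx => ⟨hzero x (by linarith), ?_⟩, fun x hx => ⟨hone x (by linarith), ?_⟩, fun x => ?_⟩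
  · have hev : (fun x => Real.smoothTransition (h x)) =ᶠ[𝓝 x] fun _ => 0 := by
      have : ∀ᶠ y in 𝓝 x, Metric.infDist y E < 3 * ε / 8 :=
        (Metric.continuous_infDist_pt E).continuousAt.eventually
          (eventually_lt_nhds (by linarith))
      exact this.mono fun y hy => hzero y hy.le
    simp [gradient, hev.fderiv_eq]
  · have hev : (fun x => Real.smoothTransition (h x)) =ᶠ[𝓝 x] fun _ => 1 := by
      have : ∀ᶠ y in 𝓝 x, 7 * ε / 8 < Metric.infDist y E :=
        (Metric.continuous_infDist_pt E).continuousAt.eventually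
          (eventually_gt_nhds (by linarith))
      exact this.mono fun y hy => hone y hy.le
    simp [gradient, hev.fderiv_eq]
  · rw [norm_gradient_eq_norm_fderiv]
    have h1 := (Real.smoothTransition.contDiff (n := 1) |>.differentiable (by simp)
      (h x)).hasDerivAt.comp_hasFDerivAt x (hhs.differentiable (by simp) x).hasFDerivAt
    have h2 : fderiv ℝ (fun x => Real.smoothTransition (h x)) x = _ := h1.fderiv
    rw [h2, norm_smul]
    have h3 : fderiv ℝ h x = (4 / ε) • fderiv ℝ g x := by
      rw [hh, fderiv_const_mul ((hg.differentiable (by simp) x).sub_const _), fderiv_sub_const]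
    rw [h3, norm_smul, Real.norm_of_nonneg (by positivity : (0 : ℝ) ≤ 4 / ε)]
    have h4 : ‖fderiv ℝ g x‖ ≤ 1 := by simpa using norm_fderiv_le_of_lipschitz ℝ hgl (x₀ := x)
    calc _ ≤ c * (4 / ε * 1) := by gcongr; exact hc _
      _ = 4 * c / ε := by ring

/-! ### Young-type inequalities, uniform in a bounded exponent. -/

/-- If Y ≤ δX the first term suffices; otherwise X ≤ δ⁻¹Y and the second does. Since δ⁻¹ ≥ 1, its
exponent p - 1 may be raised to P, which keeps the constant independent of the point when p varies.
-/
theorem rpow_sub_one_mul_le {X Y p P δ : ℝ} (hX : 0 ≤ X) (hY : 0 ≤ Y) (hp : 1 < p) (hpP : p ≤ P)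
    (hδ : 0 < δ) (hδ1 : δ ≤ 1) : X ^ (p - 1) * Y ≤ δ * X ^ p + δ⁻¹ ^ P * Y ^ p := by
  have hXp : ∀ Z : ℝ, 0 ≤ Z → Z ^ (p - 1) * Z = Z ^ p := by
    intro Z hZ
    rcases hZ.eq_or_lt with rfl | hZ
    · rw [mul_zero, Real.zero_rpow (by linarith)]
    · rw [← Real.rpow_add_one hZ.ne', sub_add_cancel]
  rcases le_or_gt Y (δ * X) with h | h
  · have : X ^ (p - 1) * Y ≤ δ * X ^ p := by
      calc X ^ (p - 1) * Y ≤ X ^ (p - 1) * (δ * X) := by gcongr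
        _ = δ * (X ^ (p - 1) * X) := by ring
        _ = δ * X ^ p := by rw [hXp X hX]
    have : 0 ≤ δ⁻¹ ^ P * Y ^ p := by positivity
    linarith
  · have hXY : X ≤ δ⁻¹ * Y := by
      rw [le_inv_mul_iff₀ hδ]; exact h.le
    have h1 : (1 : ℝ) ≤ δ⁻¹ := (one_le_inv₀ hδ).2 hδ1
    have : X ^ (p - 1) * Y ≤ δ⁻¹ ^ P * Y ^ p := by
      calc X ^ (p - 1) * Y ≤ (δ⁻¹ * Y) ^ (p - 1) * Y := by
            gcongr
        _ = δ⁻¹ ^ (p - 1) * (Y ^ (p - 1) * Y) := by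
            rw [Real.mul_rpow (by positivity) hY]; ring
        _ = δ⁻¹ ^ (p - 1) * Y ^ p := by rw [hXp Y hY]
        _ ≤ δ⁻¹ ^ P * Y ^ p := by
            gcongr
            linarith
    have : 0 ≤ δ * X ^ p := by positivity
    linarith

/-- The previous inequality with X = a^{1/(p-1)} and δ = 1. -/
theorem mul_le_rpow_conj_add_rpow {a Y p : ℝ} (ha : 0 ≤ a) (hY : 0 ≤ Y) (hp : 1 < p) :
    a * Y ≤ a ^ (p / (p - 1)) + Y ^ p := by
  have hp1 : 0 < p - 1 := by linarith
  have h := rpow_sub_one_mul_le (X := a ^ (1 / (p - 1))) (by positivity) hY hp le_rfl one_pos le_rfl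
  rw [← Real.rpow_mul ha, ← Real.rpow_mul ha, one_div_mul_cancel hp1.ne', Real.rpow_one] at h
  simpa [div_eq_inv_mul] using h

/-- Young's inequality with a weight. -/
theorem le_rpow_mul_weight_add {s ϑ p : ℝ} (hs : 0 ≤ s) (hϑ : 0 < ϑ) (hp : 1 < p) :
    s ≤ s ^ p * ϑ + ϑ ^ (-(1 / (p - 1))) := by
  have hp1 : 0 < p - 1 := by linarith
  have hp0 : 0 < p := by linarith
  -- The factorisation s = ϑ^{-1/p} · (s ϑ^{1/p}) turns the two powers into the dual weight and the
  -- weighted power of `s`.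
  have h := mul_le_rpow_conj_add_rpow (a := ϑ ^ (-(1 / p))) (Y := s * ϑ ^ (1 / p)) (by positivity)
    (by positivity) hp
  rw [Real.mul_rpow hs (by positivity), ← Real.rpow_mul hϑ.le, ← Real.rpow_mul hϑ.le,
    one_div_mul_cancel hp0.ne', Real.rpow_one, Real.rpow_neg hϑ.le (1 / p)] at h
  have e1 : -(1 / p) * (p / (p - 1)) = -(1 / (p - 1)) := by field_simp
  rw [e1] at h
  have e2 : (ϑ ^ (1 / p))⁻¹ * (s * ϑ ^ (1 / p)) = s := by
    have : 0 < ϑ ^ (1 / p) := by positivity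
    field_simp
  linarith

/-- Enlarging the factor to max(1, c) permits replacing the variable exponent by its upper bound, so
the constant does not depend on the point. -/
theorem mul_rpow_le_max_rpow_mul {c s p P : ℝ} (hc : 0 ≤ c) (hs : 0 ≤ s) (hp : 0 ≤ p)
    (hpP : p ≤ P) : (c * s) ^ p ≤ max 1 c ^ P * s ^ p := by
  rw [Real.mul_rpow hc hs]
  gcongr
  calc c ^ p ≤ max 1 c ^ p := Real.rpow_le_rpow hc (le_max_right _ _) hp
    _ ≤ max 1 c ^ P := Real.rpow_le_rpow_of_exponent_le (le_max_left _ _) hpP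

theorem add_rpow_le_two_rpow_mul {s t p P : ℝ} (hs : 0 ≤ s) (ht : 0 ≤ t) (hp : 0 ≤ p)
    (hpP : p ≤ P) : (s + t) ^ p ≤ 2 ^ P * (s ^ p + t ^ p) := by
  calc (s + t) ^ p ≤ (2 * max s t) ^ p := by
        gcongr
        rcases le_total s t with h | h
        · rw [max_eq_right h]; linarith
        · rw [max_eq_left h]; linarith
    _ ≤ max 1 2 ^ P * max s t ^ p := mul_rpow_le_max_rpow_mul (by norm_num)
        (le_max_of_le_left hs) hp hpP
    _ ≤ 2 ^ P * (s ^ p + t ^ p) := by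
        rw [max_eq_right (by norm_num : (1 : ℝ) ≤ 2)]
        gcongr
        have : 0 ≤ s ^ p := by positivity
        have : 0 ≤ t ^ p := by positivity
        rcases le_total s t with h | h
        · rw [max_eq_right h]; linarith
        · rw [max_eq_left h]; linarith

/-! ### Variable exponent spaces. -/

section

variable {n : ℕ} {F : Type*} [NormedAddCommGroup F] {S Ω : Set (Rn n)} {p ϑ : Rn n → ℝ} {P : ℝ}

theorem aestronglyMeasurable_norm_rpow_mul {f : Rn n → F}
    (hp : AEMeasurable p (volume.restrict S)) (hϑ : AEStronglyMeasurable ϑ (volume.restrict S))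
    (hf : AEStronglyMeasurable f (volume.restrict S)) :
    AEStronglyMeasurable (fun x => ‖f x‖ ^ p x * ϑ x) (volume.restrict S) :=
  ((hf.norm.aemeasurable.pow hp).mul hϑ.aemeasurable).aestronglyMeasurable

/-- A bounded exponent allows the scaling `t` to be absorbed into the constant max(1, 1/t)^P. -/
theorem MemLVar.integrableOn (hp : AEMeasurable p (volume.restrict S))
    (hϑ : AEStronglyMeasurable ϑ (volume.restrict S))
    (hpP : ∀ᵐ x ∂(volume.restrict S), 0 ≤ p x ∧ p x ≤ P)
    (hϑ0 : ∀ᵐ x ∂(volume.restrict S), 0 ≤ ϑ x) {f : Rn n → F} (hf : MemLVar S p ϑ f) :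
    IntegrableOn (fun x => ‖f x‖ ^ p x * ϑ x) S := by
  obtain ⟨hfm, t, ht, hint⟩ := hf
  refine ⟨aestronglyMeasurable_norm_rpow_mul hp hϑ hfm, ?_⟩
  rw [hasFiniteIntegral_iff_norm]
  have hle : ∫⁻ x in S, ENNReal.ofReal ‖‖f x‖ ^ p x * ϑ x‖ ≤
      ∫⁻ x in S, ENNReal.ofReal (max 1 t⁻¹ ^ P) *
        ENNReal.ofReal ((t * ‖f x‖) ^ p x * ϑ x) := by
    refine lintegral_mono_ae ?_
    filter_upwards [hpP, hϑ0] with x hx h0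
    rw [← ENNReal.ofReal_mul (by positivity), Real.norm_of_nonneg (by positivity), ← mul_assoc]
    gcongr
    have := mul_rpow_le_max_rpow_mul (c := t⁻¹) (s := t * ‖f x‖) (by positivity) (by positivity)
      hx.1 hx.2
    rwa [inv_mul_cancel_left₀ ht.ne'] at this
  refine hle.trans_lt ?_
  rw [lintegral_const_mul' _ _ ENNReal.ofReal_ne_top]
  exact ENNReal.mul_lt_top ENNReal.ofReal_lt_top hint

theorem memLVar_of_integrableOn {f : Rn n → F} (hf : AEStronglyMeasurable f (volume.restrict S))
    (hint : IntegrableOn (fun x => ‖f x‖ ^ p x * ϑ x) S) : MemLVar S p ϑ f := by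
  refine ⟨hf, 1, one_pos, lt_of_le_of_lt (lintegral_mono fun x => ?_)
    ((hasFiniteIntegral_iff_norm _).1 hint.2)⟩
  rw [one_mul]
  exact ENNReal.ofReal_le_ofReal (le_abs_self _)

/-- Multiplication by a smooth function supported in `U` maps functions on `U` which are locally
in the Sobolev space into the Sobolev space. -/
theorem HasWeakGrad.memW_smooth_mul {U : Set (Rn n)} (hU : IsOpen U) (hΩ : IsOpen Ω) (hUΩ : U ⊆ Ω)
    (hp : AEMeasurable p (volume.restrict Ω)) (hϑ : AEStronglyMeasurable ϑ (volume.restrict Ω))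
    (hpP : ∀ᵐ x ∂(volume.restrict Ω), 0 < p x ∧ p x ≤ P)
    (hϑ0 : ∀ᵐ x ∂(volume.restrict Ω), 0 ≤ ϑ x)
    {f : Rn n → ℝ} {g : Rn n → Rn n} (h : HasWeakGrad U f g)
    (hf : ∀ K, IsCompact K → K ⊆ U → IntegrableOn (fun x => ‖f x‖ ^ p x * ϑ x) K)
    (hg : ∀ K, IsCompact K → K ⊆ U → IntegrableOn (fun x => ‖g x‖ ^ p x * ϑ x) K)
    {η : Rn n → ℝ} (hη : ContDiff ℝ ((⊤ : ℕ∞) : WithTop ℕ∞) η) (hηc : HasCompactSupport η)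
    (hηU : tsupport η ⊆ U) :
    MemW Ω p ϑ (fun x => η x * f x) (fun x => η x • g x + f x • gradient η x) := by
  have hw := h.smooth_mul hU hΩ hUΩ hη (Set.inter_subset_right.trans hηU)
  obtain ⟨S₁, hS₁⟩ := hη.continuous.bounded_above_of_compact_support hηc
  obtain ⟨S₂, hS₂⟩ := (continuous_gradient hη).bounded_above_of_compact_support
    (hηc.mono' (by
      intro x hx
      by_contra h'
      exact hx (gradient_eq_zero_of_notMem_tsupport h')))
  set S := max S₁ S₂
  have hS0 : 0 ≤ S := ((norm_nonneg _).trans (hS₁ 0)).trans (le_max_left _ _)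
  have hηS : ∀ x, ‖η x‖ ≤ S := fun x => (hS₁ x).trans (le_max_left _ _)
  have hgS : ∀ x, ‖gradient η x‖ ≤ S := fun x => (hS₂ x).trans (le_max_right _ _)
  have hKΩ : tsupport η ⊆ Ω := hηU.trans hUΩ
  -- One majorant serves both the product and its gradient: each has norm at most S(|g| + |f|) and
  -- vanishes off the support of `η`.
  set G : Rn n → ℝ := (tsupport η).indicator
    fun x => max 1 S ^ P * 2 ^ P * (‖g x‖ ^ p x * ϑ x + ‖f x‖ ^ p x * ϑ x) with hG
  have hGi : IntegrableOn G Ω := by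
    refine Integrable.integrableOn ?_
    rw [hG, integrable_indicator_iff (isClosed_tsupport η).measurableSet]
    exact ((hg _ hηc hηU).add (hf _ hηc hηU)).const_mul _
  have main : ∀ {F' : Type} [NormedAddCommGroup F'] (k : Rn n → F'),
      AEStronglyMeasurable k (volume.restrict Ω) → (∀ x ∉ tsupport η, k x = 0) →
      (∀ x, ‖k x‖ ≤ S * (‖g x‖ + ‖f x‖)) → MemLVar Ω p ϑ k := by
    intro F' _ k hk hk0 hkS
    refine memLVar_of_integrableOn hk (hGi.mono' (aestronglyMeasurable_norm_rpow_mul hp hϑ hk) ?_)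
    filter_upwards [hpP, hϑ0] with x hx h0
    rw [Real.norm_of_nonneg (by positivity)]
    by_cases hxη : x ∈ tsupport η
    · rw [hG, Set.indicator_of_mem hxη]
      calc ‖k x‖ ^ p x * ϑ x ≤ (S * (‖g x‖ + ‖f x‖)) ^ p x * ϑ x := by
            gcongr
            · exact hx.1.le
            · exact hkS x
        _ ≤ max 1 S ^ P * (2 ^ P * (‖g x‖ ^ p x + ‖f x‖ ^ p x)) * ϑ x := by
            gcongr
            refine (mul_rpow_le_max_rpow_mul hS0 (by positivity) hx.1.le hx.2).trans ?_
            gcongr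
            exact add_rpow_le_two_rpow_mul (norm_nonneg _) (norm_nonneg _) hx.1.le hx.2
        _ = _ := by ring
    · rw [hG, Set.indicator_of_notMem hxη, hk0 x hxη, norm_zero, Real.zero_rpow hx.1.ne', zero_mul]
  refine ⟨hw, main _ hw.locInt.aestronglyMeasurable (fun x hx => ?_) fun x => ?_,
    main _ hw.locInt_grad.aestronglyMeasurable (fun x hx => ?_) fun x => ?_⟩
  · rw [image_eq_zero_of_notMem_tsupport hx, zero_mul]
  · rw [norm_mul]
    gcongr
    · exact hηS x
    · linarith [norm_nonneg (g x)]
  · rw [image_eq_zero_of_notMem_tsupport hx, gradient_eq_zero_of_notMem_tsupport hx]; simp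
  · refine (norm_add_le _ _).trans ?_
    rw [norm_smul, norm_smul, mul_add]
    refine add_le_add (mul_le_mul_of_nonneg_right (hηS x) (norm_nonneg _)) ?_
    rw [mul_comm]
    exact mul_le_mul_of_nonneg_right (hgS x) (norm_nonneg _)

end

/-! ### The abstract removability setting and vanishing shell integrals. -/

/-- The shell of points of `Ω` at distance between `ε / 4` and `ε` from `E`. -/
def distShell {n : ℕ} (Ω E : Set (Rn n)) (ε : ℝ) : Set (Rn n) :=
  {x | x ∈ Ω ∧ ε / 4 < Metric.infDist x E ∧ Metric.infDist x E < ε}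

theorem measurableSet_distShell {n : ℕ} {Ω E : Set (Rn n)} (hΩ : IsOpen Ω) (ε : ℝ) :
    MeasurableSet (distShell Ω E ε) := by
  have hc := Metric.continuous_infDist_pt E
  exact hΩ.measurableSet.inter ((isOpen_lt continuous_const hc).measurableSet.inter
    (isOpen_lt hc continuous_const).measurableSet)

/-- What the removability argument uses about a sub-solution `v` off `E` with gradient `g`, the
fields `V = A(x, v, g)` and `b = B(x, v)`, and a locally integrable function `h` that controls the
lower order terms. -/
structure RemovableSetting {n : ℕ} (Ω E : Set (Rn n)) (p ϑ v : Rn n → ℝ) (g V : Rn n → Rn n)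
    (b h : Rn n → ℝ) (P μ L : ℝ) (m : ℕ) : Prop where
  isOpen : IsOpen Ω
  isCompact : IsCompact E
  subset : E ⊆ Ω
  nonempty : E.Nonempty
  null : volume E = 0
  meas_exp : AEMeasurable p (volume.restrict Ω)
  exp : ∀ᵐ x ∂(volume.restrict Ω), 1 < p x ∧ p x ≤ P
  weight : IsWeight Ω p ϑ
  pos : 0 < μ
  nonneg : 0 ≤ L
  one_le : 1 ≤ m
  v_nonneg : ∀ᵐ x ∂(volume.restrict Ω), 0 ≤ v x
  rpow_le : ∀ᵐ x ∂(volume.restrict Ω), v x ^ p x * ϑ x ≤ h x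
  locInt : LocallyIntegrableOn h Ω
  grad : HasWeakGrad (Ω \ E) v g
  grad_int : ∀ K, IsCompact K → K ⊆ Ω \ E → IntegrableOn (fun x => ‖g x‖ ^ p x * ϑ x) K
  meas_V : AEStronglyMeasurable V (volume.restrict Ω)
  meas_b : AEStronglyMeasurable b (volume.restrict Ω)
  coercive : ∀ᵐ x ∂(volume.restrict Ω),
    μ * (‖g x‖ ^ p x * ϑ x) - h x ≤ inner ℝ (V x) (g x)
  -- The number `Y` is left free: it becomes `v |∇χ|` in the Caccioppoli estimate, and later `c / ε`
  -- or `‖dφ x‖`. The factor μ/2 leaves half of the coercive term to spare.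
  bound_V : ∀ᵐ x ∂(volume.restrict Ω), ∀ Y χ : ℝ, 0 ≤ Y → 0 ≤ χ → χ ≤ 1 →
    m * (‖V x‖ * χ ^ (m - 1) * Y) ≤
      μ / 2 * (‖g x‖ ^ p x * ϑ x) * χ ^ m + L * (Y ^ p x * ϑ x) + h x
  bound_b : ∀ᵐ x ∂(volume.restrict Ω), ∀ Y : ℝ, 0 ≤ Y → |b x| * Y ≤ L * (Y ^ p x * ϑ x) + h x
  -- The summand `v x ^ p x` serves errors in which the cutoff gradient is multiplied by `v`, the
  -- summand 1 those in which it is multiplied by a bounded function.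
  decay : Tendsto (fun ε : ℝ => ∫⁻ x in distShell Ω E ε,
    ENNReal.ofReal (ε ^ (-P) * ((v x ^ p x + 1) * ϑ x))) (𝓝[>] 0) (𝓝 0)
  sub : ∀ (φ : Rn n → ℝ) (dφ : Rn n → Rn n), MemW Ω p ϑ φ dφ →
    (∀ᵐ x ∂(volume.restrict Ω), 0 ≤ φ x) →
    (∃ K : Set (Rn n), IsCompact K ∧ K ⊆ Ω \ E ∧
      ∀ᵐ x ∂(volume.restrict Ω), x ∉ K → φ x = 0) →
    IntegrableOn (fun x => inner ℝ (V x) (dφ x) + b x * φ x) (Ω \ E) ∧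
    ∫ x in Ω \ E, (inner ℝ (V x) (dφ x) + b x * φ x) ≤ 0

namespace RemovableSetting

variable {n : ℕ} {Ω E : Set (Rn n)} {p ϑ v : Rn n → ℝ} {g V : Rn n → Rn n}
    {b h : Rn n → ℝ} {P μ L : ℝ} {m : ℕ}

theorem restrict_diff (H : RemovableSetting Ω E p ϑ v g V b h P μ L m) :
    volume.restrict (Ω \ E) = volume.restrict Ω :=
  Measure.restrict_congr_set (sdiff_null_ae_eq_self H.null)

theorem isOpen_diff (H : RemovableSetting Ω E p ϑ v g V b h P μ L m) : IsOpen (Ω \ E) :=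
  H.isOpen.sdiff H.isCompact.isClosed

theorem aestronglyMeasurable_weight (H : RemovableSetting Ω E p ϑ v g V b h P μ L m) :
    AEStronglyMeasurable ϑ (volume.restrict Ω) := H.weight.locInt.aestronglyMeasurable

theorem aestronglyMeasurable_v (H : RemovableSetting Ω E p ϑ v g V b h P μ L m) :
    AEStronglyMeasurable v (volume.restrict Ω) := by
  rw [← H.restrict_diff]; exact H.grad.locInt.aestronglyMeasurable

theorem aestronglyMeasurable_g (H : RemovableSetting Ω E p ϑ v g V b h P μ L m) :
    AEStronglyMeasurable g (volume.restrict Ω) := by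
  rw [← H.restrict_diff]; exact H.grad.locInt_grad.aestronglyMeasurable

theorem infDist_pos (H : RemovableSetting Ω E p ϑ v g V b h P μ L m) {x : Rn n} (hx : x ∉ E) :
    0 < Metric.infDist x E :=
  (H.isCompact.isClosed.notMem_iff_infDist_pos H.nonempty).1 hx

theorem integrableOn_rpow (H : RemovableSetting Ω E p ϑ v g V b h P μ L m) {K : Set (Rn n)}
    (hK : IsCompact K) (hKΩ : K ⊆ Ω) : IntegrableOn (fun x => ‖v x‖ ^ p x * ϑ x) K := by
  refine Integrable.mono' (H.locInt.integrableOn_compact_subset hKΩ hK)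
    ((aestronglyMeasurable_norm_rpow_mul H.meas_exp H.aestronglyMeasurable_weight
      H.aestronglyMeasurable_v).mono_measure (Measure.restrict_mono_set _ hKΩ)) ?_
  refine ae_restrict_of_ae_restrict_of_subset hKΩ ?_
  filter_upwards [H.v_nonneg, H.rpow_le, H.weight.pos] with x h1 h2 h3
  rw [Real.norm_of_nonneg (by positivity), Real.norm_of_nonneg h1]
  exact h2

/-- Families of functions that live on shells shrinking to `E`, and are controlled there by an
integrable function and by the decaying density, have vanishing integrals. -/
theorem tendsto_integral_shell (H : RemovableSetting Ω E p ϑ v g V b h P μ L m)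
    {G : Rn n → ℝ} (hG : IntegrableOn G Ω) {c : ℝ} (hc : 0 ≤ c) {R : ℝ → Rn n → ℝ}
    (hR : ∀ᶠ ε in 𝓝[>] (0 : ℝ), ∀ᵐ x ∂(volume.restrict Ω), |R ε x| ≤ (distShell Ω E ε).indicator
      (fun x => |G x| + c * (ε ^ (-P) * ((v x ^ p x + 1) * ϑ x))) x) :
    Tendsto (fun ε => ∫ x in Ω, R ε x) (𝓝[>] 0) (𝓝 0) := by
  have hE0 : ∀ᵐ x ∂(volume.restrict Ω), x ∉ E :=
    ae_restrict_of_ae (measure_eq_zero_iff_ae_notMem.1 H.null)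
  have hms : ∀ ε, MeasurableSet (distShell Ω E ε) := measurableSet_distShell H.isOpen
  -- Each point off `E` leaves the shell once `ε` is below its distance, so dominated convergence
  -- removes the integrable part; `decay` removes the rest.
  have t1 : Tendsto (fun ε : ℝ => ∫⁻ x in Ω, (distShell Ω E ε).indicator (fun x => ‖G x‖ₑ) x)
      (𝓝[>] 0) (𝓝 (∫⁻ _ in Ω, 0)) := by
    refine tendsto_lintegral_filter_of_dominated_convergence' (fun x => ‖G x‖ₑ)
      (Eventually.of_forall fun ε => hG.aestronglyMeasurable.enorm.indicator (hms ε))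
      (Eventually.of_forall fun ε => Eventually.of_forall fun x => Set.indicator_le_self _ _ x)
      hG.2.ne ?_
    filter_upwards [hE0] with x hx
    have hd := H.infDist_pos hx
    have hev : ∀ᶠ ε : ℝ in 𝓝[>] 0, ε < Metric.infDist x E :=
      (eventually_lt_nhds hd).filter_mono nhdsWithin_le_nhds
    refine tendsto_const_nhds.congr' ?_
    filter_upwards [hev] with ε hε
    rw [Set.indicator_of_notMem]
    exact fun h => lt_asymm h.2.2 hε
  have t2 := (ENNReal.Tendsto.const_mul (a := ENNReal.ofReal c) H.decay
    (Or.inr ENNReal.ofReal_ne_top))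
  have t3 := t1.add t2
  simp only [lintegral_zero, mul_zero, add_zero] at t3
  rw [tendsto_zero_iff_enorm_tendsto_zero]
  refine tendsto_of_tendsto_of_tendsto_of_le_of_le' tendsto_const_nhds t3
    (Eventually.of_forall fun _ => zero_le) ?_
  filter_upwards [hR, self_mem_nhdsWithin] with ε hε hε0
  have hε0 : 0 < ε := hε0
  have hsub : distShell Ω E ε ⊆ Ω := fun x hx => hx.1
  calc ‖∫ x in Ω, R ε x‖ₑ ≤ ∫⁻ x in Ω, ‖R ε x‖ₑ := enorm_integral_le_lintegral_enorm _
    _ ≤ ∫⁻ x in Ω, ((distShell Ω E ε).indicator (fun x => ‖G x‖ₑ) x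
          + (distShell Ω E ε).indicator (fun x => ENNReal.ofReal c *
            ENNReal.ofReal (ε ^ (-P) * ((v x ^ p x + 1) * ϑ x))) x) := by
        refine lintegral_mono_ae ?_
        filter_upwards [hε, H.v_nonneg, H.weight.pos] with x hx hv hw
        by_cases hxs : x ∈ distShell Ω E ε
        · rw [Set.indicator_of_mem hxs] at hx ⊢
          rw [Set.indicator_of_mem hxs, Real.enorm_eq_ofReal_abs, Real.enorm_eq_ofReal_abs,
            ← ENNReal.ofReal_mul hc, ← ENNReal.ofReal_add (abs_nonneg _) (by positivity)]
          exact ENNReal.ofReal_le_ofReal hx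
        · rw [Set.indicator_of_notMem hxs] at hx ⊢
          have : R ε x = 0 := abs_eq_zero.1 (le_antisymm hx (abs_nonneg _))
          simp [this]
    _ = _ := by
        rw [lintegral_add_left' (hG.aestronglyMeasurable.enorm.indicator (hms ε)),
          lintegral_indicator (hms ε) (fun x => ENNReal.ofReal c *
            ENNReal.ofReal (ε ^ (-P) * ((v x ^ p x + 1) * ϑ x))),
          Measure.restrict_restrict_of_subset hsub,
          lintegral_const_mul' _ _ ENNReal.ofReal_ne_top]

end RemovableSetting

theorem gradient_mul_eq {n : ℕ} {f g : Rn n → ℝ} {x : Rn n} (hf : DifferentiableAt ℝ f x)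
    (hg : DifferentiableAt ℝ g x) :
    gradient (fun x => f x * g x) x = f x • gradient g x + g x • gradient f x := by
  simp [gradient, fderiv_fun_mul hf hg]

theorem gradient_pow_eq {n : ℕ} {f : Rn n → ℝ} {x : Rn n} (hf : DifferentiableAt ℝ f x) (m : ℕ) :
    gradient (fun x => f x ^ m) x = (m * f x ^ (m - 1)) • gradient f x := by
  simp [gradient, fderiv_fun_pow m hf]

/-- As 1/ε ≥ 1, its exponent may be raised from p to P. This converts a cutoff gradient of order 1/ε
into the factor ε^{-P} of the decay statement. -/
theorem div_mul_rpow_le {c ε s p P : ℝ} (hc : 0 ≤ c) (hε : 0 < ε) (hε1 : ε ≤ 1) (hs : 0 ≤ s)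
    (hp : 0 ≤ p) (hpP : p ≤ P) : (c / ε * s) ^ p ≤ max 1 c ^ P * (ε ^ (-P) * s ^ p) := by
  have h1 := mul_rpow_le_max_rpow_mul hc (s := ε⁻¹ * s) (by positivity) hp hpP
  have h2 := mul_rpow_le_max_rpow_mul (c := ε⁻¹) (by positivity) hs hp hpP
  rw [max_eq_right ((one_le_inv₀ hε).2 hε1), Real.inv_rpow hε.le, ← Real.rpow_neg hε.le] at h2
  rw [div_eq_mul_inv, mul_assoc]
  exact h1.trans (by gcongr)

/-! ### The Caccioppoli estimate up to the singular set. -/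

namespace RemovableSetting

variable {n : ℕ} {Ω E : Set (Rn n)} {p ϑ v : Rn n → ℝ} {g V : Rn n → Rn n}
    {b h : Rn n → ℝ} {P μ L : ℝ} {m : ℕ}

theorem integrableOn_shell (H : RemovableSetting Ω E p ϑ v g V b h P μ L m) {ε : ℝ} (hε : 0 < ε)
    (hfin : ∫⁻ x in distShell Ω E ε, ENNReal.ofReal (ε ^ (-P) * ((v x ^ p x + 1) * ϑ x)) < ⊤) :
    IntegrableOn (fun x => ε ^ (-P) * ((v x ^ p x + 1) * ϑ x)) (distShell Ω E ε) := by
  have hsub : distShell Ω E ε ⊆ Ω := fun x hx => hx.1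
  refine ⟨AEStronglyMeasurable.mono_measure ?_ (Measure.restrict_mono_set _ hsub), ?_⟩
  · exact ((((H.aestronglyMeasurable_v.aemeasurable.pow H.meas_exp).add_const 1).mul
      H.aestronglyMeasurable_weight.aemeasurable).const_mul _).aestronglyMeasurable
  · rw [hasFiniteIntegral_iff_norm]
    refine lt_of_le_of_lt (lintegral_mono_ae ?_) hfin
    refine ae_restrict_of_ae_restrict_of_subset hsub ?_
    filter_upwards [H.v_nonneg, H.weight.pos] with x h1 h2
    rw [Real.norm_of_nonneg (by positivity)]

/-- The Caccioppoli estimate: the gradient is integrable up to `E`. -/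
theorem integrableOn_grad (H : RemovableSetting Ω E p ϑ v g V b h P μ L m) {K : Set (Rn n)}
    (hK : IsCompact K) (hKΩ : K ⊆ Ω) : IntegrableOn (fun x => ‖g x‖ ^ p x * ϑ x) K := by
  obtain ⟨ζ, hζ, hζc, hζΩ, hζI, hζ1⟩ := exists_smooth_cutoff hK H.isOpen hKΩ
  obtain ⟨Z, hZ⟩ := (continuous_gradient hζ).bounded_above_of_compact_support
    (hζc.mono' (by
      intro x hx
      by_contra h'
      exact hx (gradient_eq_zero_of_notMem_tsupport h')))
  have hZ0 : 0 ≤ Z := (norm_nonneg _).trans (hZ 0)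
  obtain ⟨c, hc0, hc⟩ := exists_smooth_cutoff_infDist n
  have hE0 : ∀ᵐ x ∂(volume.restrict Ω), x ∉ E :=
    ae_restrict_of_ae (measure_eq_zero_iff_ae_notMem.1 H.null)
  set K' := tsupport ζ with hK'
  have hK'm : MeasurableSet K' := (isClosed_tsupport ζ).measurableSet
  -- Coercivity, the cross term and the lower order term contribute one `h` each; the lower order
  -- term adds L · h from Y = v; the last part comes from ∇ζ off the shell. `C₂` collects the shell,
  -- where |∇χ| ≤ (c + Z)/ε because ε ≤ 1.
  set C₁ : ℝ := 3 + L + L * max 1 Z ^ P with hC₁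
  set C₂ : ℝ := L * max 1 (c + Z) ^ P with hC₂
  have hC₂0 : 0 ≤ C₂ := mul_nonneg H.nonneg (by positivity)
  have hG : AEStronglyMeasurable (fun x => ‖g x‖ ^ p x * ϑ x) (volume.restrict Ω) :=
    aestronglyMeasurable_norm_rpow_mul H.meas_exp H.aestronglyMeasurable_weight
      H.aestronglyMeasurable_g
  have hS1 : IntegrableOn (K'.indicator fun x => C₁ * h x) Ω := by
    refine Integrable.integrableOn ?_
    rw [integrable_indicator_iff hK'm]
    exact (H.locInt.integrableOn_compact_subset hζΩ hζc).const_mul _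
  set M : ℝ := (∫ x in Ω, K'.indicator (fun x => C₁ * h x) x) + C₂ with hM
  -- The bound `M` does not depend on `ε`, so it survives the exhaustion of `K \ E` below.
  have claim : ∀ᶠ ε in 𝓝[>] (0 : ℝ), ∫⁻ x in K ∩ {x | ε ≤ Metric.infDist x E},
      ENNReal.ofReal (‖g x‖ ^ p x * ϑ x) ≤ ENNReal.ofReal (2 / μ * M) := by
    filter_upwards [self_mem_nhdsWithin, H.decay.eventually (eventually_lt_nhds zero_lt_one),
      (eventually_lt_nhds (zero_lt_one (α := ℝ))).filter_mono nhdsWithin_le_nhds]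
      with ε hε hdec hε1
    have hε : 0 < ε := hε
    obtain ⟨ξ, hξ, hξI, hξ0, hξ1, hξg⟩ := hc E ε hε
    set χ : Rn n → ℝ := fun x => ζ x * ξ x with hχ
    have hχs : ContDiff ℝ ((⊤ : ℕ∞) : WithTop ℕ∞) χ := hζ.mul hξ
    have hχ0 : ∀ x, 0 ≤ χ x := fun x => mul_nonneg (hζI x).1 (hξI x).1
    have hχ1 : ∀ x, χ x ≤ 1 := fun x => mul_le_one₀ (hζI x).2 (hξI x).1 (hξI x).2
    set η : Rn n → ℝ := fun x => χ x ^ m with hη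
    have hηs : ContDiff ℝ ((⊤ : ℕ∞) : WithTop ℕ∞) η := hχs.pow m
    have hm0 : m ≠ 0 := Nat.one_le_iff_ne_zero.1 H.one_le
    have hsupp : tsupport η ⊆ K' ∩ {x | ε / 4 ≤ Metric.infDist x E} := by
      refine closure_minimal (fun x hx => ?_) ((isClosed_tsupport ζ).inter
        (isClosed_le continuous_const (Metric.continuous_infDist_pt E)))
      have hχx : χ x ≠ 0 := fun h0 => hx (by simp [hη, h0, hm0])
      refine ⟨subset_tsupport _ (left_ne_zero_of_mul hχx), ?_⟩
      by_contra hlt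
      exact right_ne_zero_of_mul hχx (hξ0 x (not_le.1 hlt).le).1
    have hηc : HasCompactSupport η :=
      hζc.of_isClosed_subset (isClosed_tsupport η) (hsupp.trans Set.inter_subset_left)
    have hηU : tsupport η ⊆ Ω \ E := by
      intro x hx
      refine ⟨hζΩ (hsupp hx).1, fun hxE => ?_⟩
      have h1 := (hsupp hx).2
      simp only [Set.mem_ofPred_eq, Metric.infDist_zero_of_mem hxE] at h1
      linarith
    -- The test function is χ^m v. It is admissible since ξ vanishes at distance at most ε/4, which
    -- keeps the support of η inside `Ω \ E`.
    have hmem := H.grad.memW_smooth_mul H.isOpen_diff H.isOpen Set.sdiff_subset H.meas_exp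
      H.aestronglyMeasurable_weight (H.exp.mono fun x hx => ⟨by linarith [hx.1], hx.2⟩)
      (H.weight.pos.mono fun x hx => hx.le)
      (fun K hK hKU => H.integrableOn_rpow hK (hKU.trans Set.sdiff_subset)) H.grad_int hηs hηc hηU
    obtain ⟨hint, hle⟩ := H.sub _ _ hmem
      (H.v_nonneg.mono fun x hx => mul_nonneg (pow_nonneg (hχ0 x) m) hx)
      ⟨tsupport η, hηc, hηU, Eventually.of_forall fun x hx => by
        rw [image_eq_zero_of_notMem_tsupport hx, zero_mul]⟩
    set I : Rn n → ℝ := fun x => inner ℝ (V x) (η x • g x + v x • gradient η x)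
      + b x * (η x * v x) with hI
    rw [IntegrableOn, H.restrict_diff] at hint
    rw [H.restrict_diff] at hle
    set D : Rn n → ℝ := fun x => ε ^ (-P) * ((v x ^ p x + 1) * ϑ x) with hD
    have hDi : IntegrableOn D (distShell Ω E ε) := H.integrableOn_shell hε (hdec.trans (by simp))
    have hms := measurableSet_distShell (E := E) H.isOpen ε
    have hsub : distShell Ω E ε ⊆ Ω := fun x hx => hx.1
    have hS2 : IntegrableOn ((distShell Ω E ε).indicator fun x => C₂ * D x) Ω := by
      refine Integrable.integrableOn ?_
      rw [integrable_indicator_iff hms]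
      exact hDi.const_mul _
    have hS2le : ∫ x in Ω, (distShell Ω E ε).indicator (fun x => C₂ * D x) x ≤ C₂ := by
      rw [integral_indicator hms, Measure.restrict_restrict_of_subset hsub, integral_const_mul]
      have : ∫ x in distShell Ω E ε, D x ≤ 1 := by
        rw [integral_eq_lintegral_of_nonneg_ae _ hDi.aestronglyMeasurable]
        · exact ENNReal.toReal_le_of_le_ofReal zero_le_one (by simpa using hdec.le)
        · refine ae_restrict_of_ae_restrict_of_subset hsub ?_
          filter_upwards [H.v_nonneg, H.weight.pos] with x h1 h2
          exact (by positivity : 0 ≤ ε ^ (-P) * ((v x ^ p x + 1) * ϑ x))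
      nlinarith
    -- Coercivity yields μ χ^m |g|^p ϑ and the cross term consumes half of it. The remaining half is
    -- bounded by the tested integrand, whose integral is at most zero, plus a multiple of `h` and a
    -- shell term.
    have hpt : ∀ᵐ x ∂(volume.restrict Ω), μ / 2 * (‖g x‖ ^ p x * ϑ x) * χ x ^ m ≤
        I x + K'.indicator (fun x => C₁ * h x) x
          + (distShell Ω E ε).indicator (fun x => C₂ * D x) x := by
      filter_upwards [H.exp, H.weight.pos, H.v_nonneg, H.rpow_le, H.coercive, H.bound_V,
        H.bound_b, hE0, ae_restrict_mem H.isOpen.measurableSet]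
        with x hp hϑ hv hvh hco hbV hbb hxE hxΩ
      have hD0 : 0 ≤ (distShell Ω E ε).indicator (fun x => C₂ * D x) x := by
        by_cases hxs : x ∈ distShell Ω E ε
        · rw [Set.indicator_of_mem hxs]; simp only [hD]; positivity
        · rw [Set.indicator_of_notMem hxs]
      by_cases hxK : x ∈ K'
      · rw [Set.indicator_of_mem hxK]
        have hgη : gradient η x = (m * χ x ^ (m - 1)) • gradient χ x :=
          gradient_pow_eq (hχs.differentiable (by simp) x) m
        have hgχ : gradient χ x = ζ x • gradient ξ x + ξ x • gradient ζ x :=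
          gradient_mul_eq (hζ.differentiable (by simp) x) (hξ.differentiable (by simp) x)
        have hvp : 0 ≤ v x ^ p x * ϑ x := by positivity
        have hh0 : 0 ≤ h x := hvp.trans hvh
        have hL := H.nonneg
        have hgrad : (v x * ‖gradient χ x‖) ^ p x * ϑ x * L ≤ L * max 1 Z ^ P * h x +
            (distShell Ω E ε).indicator (fun x => C₂ * D x) x := by
          by_cases hxs : x ∈ distShell Ω E ε
          · rw [Set.indicator_of_mem hxs]
            have hn : ‖gradient χ x‖ ≤ (c + Z) / ε := by
              rw [hgχ]
              refine (norm_add_le _ _).trans ?_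
              rw [norm_smul, norm_smul, Real.norm_of_nonneg (hζI x).1,
                Real.norm_of_nonneg (hξI x).1, add_div]
              refine add_le_add ?_ ?_
              · exact (mul_le_of_le_one_left (norm_nonneg _) (hζI x).2).trans (hξg x)
              · refine (mul_le_of_le_one_left (norm_nonneg _) (hξI x).2).trans ((hZ x).trans ?_)
                rw [le_div_iff₀ hε]
                nlinarith
            have h1 : (v x * ‖gradient χ x‖) ^ p x ≤
                max 1 (c + Z) ^ P * (ε ^ (-P) * v x ^ p x) := by
              refine le_trans ?_ (div_mul_rpow_le (c := c + Z) (by positivity) hε hε1.le hv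
                (by linarith [hp.1]) hp.2)
              rw [mul_comm]
              gcongr
              linarith [hp.1]
            have h2 : (v x * ‖gradient χ x‖) ^ p x * ϑ x * L ≤ C₂ * D x := by
              calc _ ≤ max 1 (c + Z) ^ P * (ε ^ (-P) * v x ^ p x) * ϑ x * L := by gcongr
                _ = C₂ * (ε ^ (-P) * (v x ^ p x * ϑ x)) := by rw [hC₂]; ring
                _ ≤ C₂ * D x := by
                  simp only [hD]
                  gcongr
                  linarith
            have h3 : 0 ≤ L * max 1 Z ^ P * h x := by positivity
            linarith
          · have hξ' : gradient ξ x = 0 := by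
              by_contra hne
              refine hxs ⟨hxΩ, ?_, ?_⟩
              · by_contra hlt
                exact hne (hξ0 x (not_lt.1 hlt)).2
              · by_contra hlt
                exact hne (hξ1 x (not_lt.1 hlt)).2
            have hn : ‖gradient χ x‖ ≤ Z := by
              rw [hgχ, hξ', smul_zero, zero_add, norm_smul, Real.norm_of_nonneg (hξI x).1]
              exact (mul_le_of_le_one_left (norm_nonneg _) (hξI x).2).trans (hZ x)
            have h1 : (v x * ‖gradient χ x‖) ^ p x ≤ max 1 Z ^ P * v x ^ p x := by
              refine le_trans ?_ (mul_rpow_le_max_rpow_mul hZ0 hv (by linarith [hp.1]) hp.2)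
              rw [mul_comm]
              gcongr
              linarith [hp.1]
            calc _ ≤ max 1 Z ^ P * v x ^ p x * ϑ x * L := by gcongr
              _ = L * max 1 Z ^ P * (v x ^ p x * ϑ x) := by ring
              _ ≤ L * max 1 Z ^ P * h x := by gcongr
              _ ≤ _ := le_add_of_nonneg_right hD0
        have hIx : I x = χ x ^ m * inner ℝ (V x) (g x)
            + (m * χ x ^ (m - 1) * v x) * inner ℝ (V x) (gradient χ x)
            + b x * (χ x ^ m * v x) := by
          simp only [hI, hη, inner_add_right, inner_smul_right]
          rw [hgη, inner_smul_right]
          ring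
        have hχm0 : 0 ≤ χ x ^ m := pow_nonneg (hχ0 x) m
        have hχm1 : χ x ^ m ≤ 1 := pow_le_one₀ (hχ0 x) (hχ1 x)
        have hχm2 : 0 ≤ χ x ^ (m - 1) := pow_nonneg (hχ0 x) _
        have a1 : μ * (‖g x‖ ^ p x * ϑ x) * χ x ^ m - h x ≤
            χ x ^ m * inner ℝ (V x) (g x) := by
          have := mul_le_mul_of_nonneg_left hco hχm0
          nlinarith
        have a2 : -(μ / 2 * (‖g x‖ ^ p x * ϑ x) * χ x ^ m
            + L * ((v x * ‖gradient χ x‖) ^ p x * ϑ x) + h x)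
            ≤ (m * χ x ^ (m - 1) * v x) * inner ℝ (V x) (gradient χ x) := by
          have e1 := hbV (v x * ‖gradient χ x‖) (χ x) (by positivity) (hχ0 x) (hχ1 x)
          have e2 := (abs_le.1 (abs_real_inner_le_norm (V x) (gradient χ x))).1
          have e3 := mul_le_mul_of_nonneg_left e2
            (by positivity : 0 ≤ (m : ℝ) * χ x ^ (m - 1) * v x)
          linarith
        have a3 : -((L + 1) * h x) ≤ b x * (χ x ^ m * v x) := by
          have e1 := hbb (v x) hv
          have e2 : |b x * (χ x ^ m * v x)| ≤ |b x| * v x := by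
            rw [abs_mul, abs_of_nonneg (mul_nonneg hχm0 hv)]
            gcongr
            exact mul_le_of_le_one_left hv hχm1
          have e3 := neg_le_of_abs_le e2
          have e4 : L * (v x ^ p x * ϑ x) ≤ L * h x := by gcongr
          linarith
        rw [hIx]
        have : C₁ * h x = 3 * h x + L * h x + L * max 1 Z ^ P * h x := by rw [hC₁]; ring
        rw [this]
        linarith
      · have hηx : x ∉ tsupport η := fun hx => hxK (hsupp hx).1
        have hζx : ζ x = 0 := image_eq_zero_of_notMem_tsupport hxK
        have hχx : χ x ^ m = 0 := by simp [hχ, hζx, hm0]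
        have hIx : I x = 0 := by
          simp only [hI]
          rw [gradient_eq_zero_of_notMem_tsupport hηx, image_eq_zero_of_notMem_tsupport hηx]
          simp
        rw [Set.indicator_of_notMem hxK, hIx, hχx]
        simpa using hD0
    have hlhs0 : ∀ᵐ x ∂(volume.restrict Ω), 0 ≤ μ / 2 * (‖g x‖ ^ p x * ϑ x) * χ x ^ m := by
      filter_upwards [H.weight.pos] with x hx
      have := H.pos
      have := hχ0 x
      positivity
    have hsum := (hint.add hS1).add hS2
    have hlhs : Integrable (fun x => μ / 2 * (‖g x‖ ^ p x * ϑ x) * χ x ^ m)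
        (volume.restrict Ω) := by
      refine hsum.mono' ((hG.const_mul _).mul hηs.continuous.aestronglyMeasurable) ?_
      filter_upwards [hpt, hlhs0] with x hx hx0
      rw [Real.norm_of_nonneg hx0]
      exact hx
    have hbound : ∫ x in Ω, μ / 2 * (‖g x‖ ^ p x * ϑ x) * χ x ^ m ≤ M := by
      have h1 := integral_mono_ae hlhs hsum hpt
      have h2 := integral_add (hint.add hS1) hS2
      have h3 := integral_add hint hS1
      have h4 : ∫ x in Ω, (I + K'.indicator (fun x => C₁ * h x)
          + (distShell Ω E ε).indicator (fun x => C₂ * D x)) x ≤ M := by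
        rw [hM]
        refine h2.le.trans ?_
        have h3' : ∫ x in Ω, (I + K'.indicator (fun x => C₁ * h x)) x
          = (∫ x in Ω, I x) + ∫ x in Ω, K'.indicator (fun x => C₁ * h x) x := h3
        linarith [h3', hle, hS2le]
      exact h1.trans h4
    have hsubK : K ∩ {x | ε ≤ Metric.infDist x E} ⊆ Ω := Set.inter_subset_left.trans hKΩ
    have hmK : MeasurableSet (K ∩ {x | ε ≤ Metric.infDist x E}) :=
      hK.isClosed.measurableSet.inter
        (isClosed_le continuous_const (Metric.continuous_infDist_pt E)).measurableSet
    calc ∫⁻ x in K ∩ {x | ε ≤ Metric.infDist x E}, ENNReal.ofReal (‖g x‖ ^ p x * ϑ x)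
        = ∫⁻ x in K ∩ {x | ε ≤ Metric.infDist x E},
          ENNReal.ofReal (2 / μ * (μ / 2 * (‖g x‖ ^ p x * ϑ x) * χ x ^ m)) := by
          refine setLIntegral_congr_fun hmK fun x hx => ?_
          have h1 : χ x = 1 := by
            have hz := hζ1.self_of_nhdsSet x hx.1
            simp [hχ, hz, (hξ1 x hx.2).1]
          have hμ := H.pos.ne'
          simp only [h1, one_pow, mul_one]
          congr 1
          field_simp
      _ ≤ ∫⁻ x in Ω, ENNReal.ofReal (2 / μ * (μ / 2 * (‖g x‖ ^ p x * ϑ x) * χ x ^ m)) :=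
          lintegral_mono_set hsubK
      _ = ENNReal.ofReal (∫ x in Ω, 2 / μ * (μ / 2 * (‖g x‖ ^ p x * ϑ x) * χ x ^ m)) := by
          rw [ofReal_integral_eq_lintegral_ofReal (hlhs.const_mul _)]
          filter_upwards [hlhs0] with x hx
          have := H.pos
          positivity
      _ ≤ ENNReal.ofReal (2 / μ * M) := by
          rw [integral_const_mul]
          have := H.pos
          gcongr
  refine ⟨hG.mono_measure (Measure.restrict_mono_set _ hKΩ), ?_⟩
  have hae : ∀ᵐ x ∂(volume.restrict K), ‖‖g x‖ ^ p x * ϑ x‖ = ‖g x‖ ^ p x * ϑ x := by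
    refine ae_restrict_of_ae_restrict_of_subset hKΩ ?_
    filter_upwards [H.weight.pos] with x hx
    exact Real.norm_of_nonneg (by positivity)
  rw [hasFiniteIntegral_iff_norm, lintegral_congr_ae (hae.mono fun x hx => by
    change ENNReal.ofReal ‖‖g x‖ ^ p x * ϑ x‖ = ENNReal.ofReal (‖g x‖ ^ p x * ϑ x)
    rw [hx])]
  -- These sets increase to `K \ E`, which is `K` up to a null set, so monotone convergence applies.
  -- The claim holds only for small `ε`, hence for each `j` a later index `N` is used.
  set s : ℕ → Set (Rn n) := fun j => K ∩ {x | 1 / ((j : ℝ) + 1) ≤ Metric.infDist x E} with hs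
  have hmono : Monotone s := by
    intro i j hij x hx
    exact ⟨hx.1, le_trans (Nat.one_div_le_one_div hij) (Set.mem_ofPred_eq ▸ hx.2)⟩
  have hunion : (⋃ j, s j : Set (Rn n)) =ᵐ[volume] K := by
    have h1 : (⋃ j, s j) = K \ E := by
      ext x
      simp only [Set.mem_iUnion, hs, Set.mem_inter_iff, Set.mem_ofPred_eq, Set.mem_sdiff]
      constructor
      · rintro ⟨j, hxK, hx⟩
        refine ⟨hxK, fun hxE => ?_⟩
        rw [Metric.infDist_zero_of_mem hxE] at hx
        have : (0 : ℝ) < 1 / ((j : ℝ) + 1) := by positivity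
        linarith
      · rintro ⟨hxK, hxE⟩
        obtain ⟨j, hj⟩ := exists_nat_one_div_lt (H.infDist_pos hxE)
        exact ⟨j, hxK, hj.le⟩
    rw [h1]
    exact sdiff_null_ae_eq_self H.null
  rw [← Measure.restrict_congr_set hunion,
    setLIntegral_iUnion_of_directed _ (hmono.directed_le)]
  refine lt_of_le_of_lt (iSup_le fun j => ?_) (ENNReal.ofReal_lt_top (r := 2 / μ * M))
  have hseq : Tendsto (fun j : ℕ => 1 / ((j : ℝ) + 1)) atTop (𝓝[>] 0) :=
    tendsto_nhdsWithin_iff.2 ⟨tendsto_one_div_add_atTop_nhds_zero_nat,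
      Eventually.of_forall fun j => by simp only [Set.mem_Ioi]; positivity⟩
  obtain ⟨N, hN, hjN⟩ := ((hseq.eventually claim).and (eventually_ge_atTop j)).exists
  exact (lintegral_mono_set (hmono hjN)).trans hN

end RemovableSetting

/-! ### Weak differentiability across the singular set. -/

namespace RemovableSetting

variable {n : ℕ} {Ω E : Set (Rn n)} {p ϑ v : Rn n → ℝ} {g V : Rn n → Rn n}
    {b h : Rn n → ℝ} {P μ L : ℝ} {m : ℕ}

/-- The weighted Young inequality bounds `v` by v^p ϑ plus the dual weight, both locally integrable
on `Ω`. -/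
theorem locallyIntegrableOn_v (H : RemovableSetting Ω E p ϑ v g V b h P μ L m) :
    LocallyIntegrableOn v Ω := by
  refine locallyIntegrableOn_of_norm_le H.isOpen (H.locInt.add H.weight.locInt_dual)
    H.aestronglyMeasurable_v ?_
  filter_upwards [H.v_nonneg, H.rpow_le, H.weight.pos, H.exp] with x h1 h2 h3 h4
  rw [Real.norm_of_nonneg h1]
  refine le_trans ?_ (le_abs_self _)
  exact (le_rpow_mul_weight_add h1 h3 h4.1).trans (by simp only [Pi.add_apply]; linarith)

/-- The same Young inequality, now fed by the Caccioppoli estimate. -/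
theorem locallyIntegrableOn_g (H : RemovableSetting Ω E p ϑ v g V b h P μ L m) :
    LocallyIntegrableOn g Ω := by
  rw [locallyIntegrableOn_iff H.isOpen.isLocallyClosed]
  intro K hKΩ hK
  refine Integrable.mono' ((H.integrableOn_grad hK hKΩ).add
    (H.weight.locInt_dual.integrableOn_compact_subset hKΩ hK))
    (H.aestronglyMeasurable_g.mono_measure (Measure.restrict_mono_set _ hKΩ)) ?_
  refine ae_restrict_of_ae_restrict_of_subset hKΩ ?_
  filter_upwards [H.weight.pos, H.exp] with x h3 h4
  exact le_rpow_mul_weight_add (norm_nonneg _) h3 h4.1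

/-- A family of smooth cutoff functions that remove `E`. -/
theorem exists_cutoff_family (H : RemovableSetting Ω E p ϑ v g V b h P μ L m) :
    ∃ (c : ℝ) (ξ : ℝ → Rn n → ℝ), 0 ≤ c ∧ (∀ ε > 0,
      ContDiff ℝ ((⊤ : ℕ∞) : WithTop ℕ∞) (ξ ε) ∧ (∀ x, ξ ε x ∈ Set.Icc (0 : ℝ) 1) ∧
      tsupport (ξ ε) ⊆ Eᶜ ∧ (∀ x, ‖gradient (ξ ε) x‖ ≤ c / ε) ∧
      ∀ x ∈ Ω, x ∉ distShell Ω E ε → gradient (ξ ε) x = 0) ∧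
      ∀ᵐ x ∂(volume.restrict Ω), ∀ᶠ ε in 𝓝[>] (0 : ℝ), ξ ε x = 1 := by
  obtain ⟨c, hc0, hc⟩ := exists_smooth_cutoff_infDist n
  have hc' : ∀ ε : ℝ, ∃ ξ : Rn n → ℝ, 0 < ε → ContDiff ℝ ((⊤ : ℕ∞) : WithTop ℕ∞) ξ ∧
      (∀ x, ξ x ∈ Set.Icc (0 : ℝ) 1) ∧
      (∀ x, Metric.infDist x E ≤ ε / 4 → ξ x = 0 ∧ gradient ξ x = 0) ∧
      (∀ x, ε ≤ Metric.infDist x E → ξ x = 1 ∧ gradient ξ x = 0) ∧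
      ∀ x, ‖gradient ξ x‖ ≤ c / ε := by
    intro ε
    by_cases hε : 0 < ε
    · obtain ⟨ξ, hξ⟩ := hc E ε hε
      exact ⟨ξ, fun _ => hξ⟩
    · exact ⟨0, fun h => absurd h hε⟩
  choose ξ hξ using hc'
  refine ⟨c, ξ, hc0, fun ε hε => ?_, ?_⟩
  · obtain ⟨h1, h2, h3, h4, h5⟩ := hξ ε hε
    refine ⟨h1, h2, ?_, h5, fun x hxΩ hx => ?_⟩
    · have hsub : tsupport (ξ ε) ⊆ {x | ε / 4 ≤ Metric.infDist x E} := by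
        refine closure_minimal (fun x hx => ?_)
          (isClosed_le continuous_const (Metric.continuous_infDist_pt E))
        by_contra hlt
        exact hx (h3 x (not_le.1 hlt).le).1
      intro x hx hxE
      have hx' : ε / 4 ≤ Metric.infDist x E := hsub hx
      rw [Metric.infDist_zero_of_mem hxE] at hx'
      linarith
    · by_contra hne
      refine hx ⟨hxΩ, ?_, ?_⟩
      · by_contra hlt
        exact hne (h3 x (not_lt.1 hlt)).2
      · by_contra hlt
        exact hne (h4 x (not_lt.1 hlt)).2
  · have hE0 : ∀ᵐ x ∂(volume.restrict Ω), x ∉ E :=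
      ae_restrict_of_ae (measure_eq_zero_iff_ae_notMem.1 H.null)
    filter_upwards [hE0] with x hx
    filter_upwards [self_mem_nhdsWithin,
      (eventually_lt_nhds (H.infDist_pos hx)).filter_mono nhdsWithin_le_nhds] with ε hε hεx
    exact ((hξ ε hε).2.2.2.1 x hεx.le).1

/-- The function is weakly differentiable across `E`. -/
theorem hasWeakGrad (H : RemovableSetting Ω E p ϑ v g V b h P μ L m) : HasWeakGrad Ω v g := by
  refine ⟨H.locallyIntegrableOn_v, H.locallyIntegrableOn_g, fun ψ hψ hψc hψΩ i => ?_⟩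
  obtain ⟨c, ξ, hc0, hξ, hξ1⟩ := H.exists_cutoff_family
  set e : Rn n := EuclideanSpace.single i 1
  have hfψ : Continuous fun x => fderiv ℝ ψ x e :=
    (hψ.continuous_fderiv (by simp)).clm_apply continuous_const
  have hcψ : HasCompactSupport fun x => fderiv ℝ ψ x e := hψc.fderiv_apply ℝ e
  obtain ⟨S, hS⟩ := hψ.continuous.bounded_above_of_compact_support hψc
  have hS0 : 0 ≤ S := (norm_nonneg _).trans (hS 0)
  have J1 : IntegrableOn (fun x => v x * fderiv ℝ ψ x e) Ω := by
    refine (integrable_smul_of_tsupport_subset H.locallyIntegrableOn_v hfψ hcψ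
      ((tsupport_fderiv_apply_subset ℝ e).trans hψΩ)).integrableOn.congr
      (Eventually.of_forall fun x => ?_)
    simp only [smul_eq_mul]; ring
  have J2 : IntegrableOn (fun x => g x i * ψ x) Ω := by
    have := (EuclideanSpace.proj (𝕜 := ℝ) i).integrable_comp
      (integrable_smul_of_tsupport_subset H.locallyIntegrableOn_g hψ.continuous hψc hψΩ)
    refine this.integrableOn.congr (Eventually.of_forall fun x => ?_)
    simp; ring
  have hξm : ∀ ε > 0, AEStronglyMeasurable (ξ ε) (volume.restrict Ω) := fun ε hε =>
    (hξ ε hε).1.continuous.aestronglyMeasurable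
  have hdom : ∀ F : Rn n → ℝ, IntegrableOn F Ω →
      Tendsto (fun ε => ∫ x in Ω, F x * ξ ε x) (𝓝[>] 0) (𝓝 (∫ x in Ω, F x)) := by
    intro F hF
    refine tendsto_integral_filter_of_dominated_convergence (fun x => ‖F x‖)
      ?_ ?_ hF.norm ?_
    · filter_upwards [self_mem_nhdsWithin] with ε hε
      exact hF.aestronglyMeasurable.mul (hξm ε hε)
    · filter_upwards [self_mem_nhdsWithin] with ε hε
      refine Eventually.of_forall fun x => ?_
      obtain ⟨h0, h1⟩ := (hξ ε hε).2.1 x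
      rw [norm_mul, Real.norm_of_nonneg h0]
      exact mul_le_of_le_one_right (norm_nonneg _) h1
    · filter_upwards [hξ1] with x hx
      refine tendsto_const_nhds.congr' ?_
      filter_upwards [hx] with ε hε
      rw [hε, mul_one]
  have lim1 := hdom _ J1
  have lim3 := hdom _ J2
  have hψm : MeasurableSet (tsupport ψ) := (isClosed_tsupport ψ).measurableSet
  -- The error of the cutoff is at most S · (c/ε) v on the shell. Young's inequality splits it into
  -- the dual weight, which is integrable on the support of ψ, and a multiple of ε^{-P} v^p ϑ.
  have lim2 : Tendsto (fun ε => ∫ x in Ω, v x * (ψ x * fderiv ℝ (ξ ε) x e)) (𝓝[>] 0) (𝓝 0) := by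
    refine H.tendsto_integral_shell
      (G := (tsupport ψ).indicator fun x => S * ϑ x ^ (-(1 / (p x - 1)))) ?_
      (c := S * max 1 c ^ P) (by positivity) ?_
    · refine Integrable.integrableOn ?_
      rw [integrable_indicator_iff hψm]
      exact (H.weight.locInt_dual.integrableOn_compact_subset hψΩ hψc).const_mul S
    · filter_upwards [self_mem_nhdsWithin,
        (eventually_lt_nhds (zero_lt_one (α := ℝ))).filter_mono nhdsWithin_le_nhds] with ε hε hε1
      have hε0 : 0 < ε := hε
      obtain ⟨-, -, -, hn, hz⟩ := hξ ε hε
      filter_upwards [H.exp, H.weight.pos, H.v_nonneg, ae_restrict_mem H.isOpen.measurableSet]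
        with x hp hϑ hv hxΩ
      rw [← gradient_apply_eq_fderiv]
      by_cases hxs : x ∈ distShell Ω E ε
      · rw [Set.indicator_of_mem hxs]
        by_cases hxψ : x ∈ tsupport ψ
        · rw [Set.indicator_of_mem hxψ]
          have e1 : |gradient (ξ ε) x i| ≤ c / ε :=
            (PiLp.norm_apply_le (gradient (ξ ε) x) i).trans (hn x)
          have e2 := le_rpow_mul_weight_add (s := c / ε * v x) (by positivity) hϑ hp.1
          have e3 := div_mul_rpow_le hc0 hε0 hε1.le hv (by linarith [hp.1]) hp.2
          have e4 : 0 ≤ ϑ x ^ (-(1 / (p x - 1))) := by positivity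
          rw [abs_of_nonneg (mul_nonneg hS0 e4), abs_mul, abs_mul, abs_of_nonneg hv]
          calc v x * (|ψ x| * |gradient (ξ ε) x i|) ≤ v x * (S * (c / ε)) := by
                gcongr
                exact hS x
            _ = S * (c / ε * v x) := by ring
            _ ≤ S * ((c / ε * v x) ^ p x * ϑ x + ϑ x ^ (-(1 / (p x - 1)))) := by gcongr
            _ ≤ S * (max 1 c ^ P * (ε ^ (-P) * v x ^ p x) * ϑ x
                + ϑ x ^ (-(1 / (p x - 1)))) := by gcongr
            _ = S * ϑ x ^ (-(1 / (p x - 1)))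
                + S * max 1 c ^ P * (ε ^ (-P) * (v x ^ p x * ϑ x)) := by ring
            _ ≤ _ := by
                gcongr
                linarith
        · rw [image_eq_zero_of_notMem_tsupport hxψ]
          simp only [zero_mul, mul_zero, abs_zero]
          positivity
      · rw [Set.indicator_of_notMem hxs, hz x hxΩ hxs]
        simp
  -- The weak identity on `Ω \ E`, tested with ψ ξ_ε and expanded by the product rule.
  have hid : ∀ᶠ ε in 𝓝[>] (0 : ℝ), (∫ x in Ω, v x * fderiv ℝ ψ x e * ξ ε x)
      + ∫ x in Ω, v x * (ψ x * fderiv ℝ (ξ ε) x e) = -∫ x in Ω, g x i * ψ x * ξ ε x := by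
    filter_upwards [self_mem_nhdsWithin] with ε hε
    obtain ⟨hs, hI, hsupp, -, -⟩ := hξ ε hε
    have hts : tsupport (fun x => ψ x * ξ ε x) ⊆ Ω \ E := fun x hx =>
      ⟨hψΩ (tsupport_mul_subset_left (f := ψ) (g := ξ ε) hx),
        hsupp (tsupport_mul_subset_right (f := ψ) (g := ξ ε) hx)⟩
    have key := H.grad.parts (fun x => ψ x * ξ ε x) (hψ.mul hs) hψc.mul_right hts i
    rw [H.restrict_diff] at key
    have hfξ : Continuous fun x => fderiv ℝ (ξ ε) x e :=
      (hs.continuous_fderiv (by simp)).clm_apply continuous_const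
    have hder : ∀ x, v x * fderiv ℝ (fun x => ψ x * ξ ε x) x e
        = v x * fderiv ℝ ψ x e * ξ ε x + v x * (ψ x * fderiv ℝ (ξ ε) x e) := by
      intro x
      rw [fderiv_fun_mul (hψ.differentiable (by simp) x) (hs.differentiable (by simp) x)]
      simp only [add_apply, smul_apply, smul_eq_mul]
      ring
    have I1 : IntegrableOn (fun x => v x * fderiv ℝ ψ x e * ξ ε x) Ω := by
      refine J1.norm.mono' (J1.aestronglyMeasurable.mul (hξm ε hε))
        (Eventually.of_forall fun x => ?_)
      obtain ⟨h0, h1⟩ := hI x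
      rw [norm_mul, Real.norm_of_nonneg h0]
      exact mul_le_of_le_one_right (norm_nonneg _) h1
    have I2 : IntegrableOn (fun x => v x * (ψ x * fderiv ℝ (ξ ε) x e)) Ω := by
      refine (integrable_smul_of_tsupport_subset H.locallyIntegrableOn_v
        (c := fun x => ψ x * fderiv ℝ (ξ ε) x e) (hψ.continuous.mul hfξ) hψc.mul_right
        ((tsupport_mul_subset_left (f := ψ)
          (g := fun x => fderiv ℝ (ξ ε) x e)).trans hψΩ)).integrableOn.congr
        (Eventually.of_forall fun x => ?_)
      simp only [smul_eq_mul]; ring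
    rw [← integral_add I1 I2]
    simp_rw [← hder, mul_assoc]
    exact key
  have := (lim1.add lim2).congr' hid
  rw [add_zero] at this
  exact tendsto_nhds_unique this lim3.neg

end RemovableSetting

/-! ### Bounded truncation and the sub-solution inequality across the singular set. -/

/-- A smooth bounded approximation of the identity function. -/
noncomputable def softTrunc (k : ℕ) (s : ℝ) : ℝ := (k + 1) * Real.arctan (s / (k + 1))

theorem hasDerivAt_softTrunc (k : ℕ) (s : ℝ) :
    HasDerivAt (softTrunc k) (1 / (1 + (s / (k + 1)) ^ 2)) s := by
  have hk : (k : ℝ) + 1 ≠ 0 := by positivity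
  have h := (((hasDerivAt_id s).div_const ((k : ℝ) + 1)).arctan).const_mul ((k : ℝ) + 1)
  refine h.congr_deriv ?_
  simp only [id]
  field_simp

theorem deriv_softTrunc (k : ℕ) (s : ℝ) :
    deriv (softTrunc k) s = 1 / (1 + (s / (k + 1)) ^ 2) := (hasDerivAt_softTrunc k s).deriv

theorem deriv_softTrunc_nonneg (k : ℕ) (s : ℝ) : 0 ≤ deriv (softTrunc k) s := by
  rw [deriv_softTrunc]; positivity

theorem deriv_softTrunc_le_one (k : ℕ) (s : ℝ) : deriv (softTrunc k) s ≤ 1 := by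
  rw [deriv_softTrunc, div_le_one (by positivity)]
  linarith [sq_nonneg (s / ((k : ℝ) + 1))]

theorem contDiff_softTrunc (k : ℕ) : ContDiff ℝ 1 (softTrunc k) :=
  contDiff_const.mul (Real.contDiff_arctan.comp (contDiff_id.div_const _))

theorem softTrunc_zero (k : ℕ) : softTrunc k 0 = 0 := by simp [softTrunc]

theorem softTrunc_nonneg (k : ℕ) {s : ℝ} (hs : 0 ≤ s) : 0 ≤ softTrunc k s :=
  mul_nonneg (by positivity) (Real.arctan_nonneg.2 (by positivity))

theorem abs_softTrunc_le (k : ℕ) (s : ℝ) : |softTrunc k s| ≤ (k + 1) * (Real.pi / 2) := by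
  rw [softTrunc, abs_mul, abs_of_nonneg (by positivity : (0 : ℝ) ≤ k + 1)]
  gcongr
  exact abs_le.2 ⟨(Real.neg_pi_div_two_lt_arctan _).le, (Real.arctan_lt_pi_div_two _).le⟩

theorem abs_softTrunc_le_abs (k : ℕ) (s : ℝ) : |softTrunc k s| ≤ |s| := by
  have h := Convex.norm_image_sub_le_of_norm_deriv_le (f := softTrunc k) (C := 1)
    (s := Set.univ) (x := 0) (y := s) (fun x _ => (hasDerivAt_softTrunc k x).differentiableAt)
    (fun x _ => by
      rw [Real.norm_of_nonneg (deriv_softTrunc_nonneg k x)]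
      exact deriv_softTrunc_le_one k x) convex_univ trivial trivial
  simpa [softTrunc_zero] using h

theorem tendsto_deriv_softTrunc (s : ℝ) :
    Tendsto (fun k => deriv (softTrunc k) s) atTop (𝓝 1) := by
  simp_rw [deriv_softTrunc]
  have h : Tendsto (fun k : ℕ => s / ((k : ℝ) + 1)) atTop (𝓝 0) := by
    simpa [div_eq_mul_inv] using
      (tendsto_one_div_add_atTop_nhds_zero_nat (𝕜 := ℝ)).const_mul s
  have := ((h.pow 2).const_add 1).inv₀ (by norm_num)
  simpa using this

theorem tendsto_softTrunc (s : ℝ) : Tendsto (fun k => softTrunc k s) atTop (𝓝 s) := by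
  rcases eq_or_ne s 0 with rfl | hs
  · simp [softTrunc_zero]
  have h : Tendsto (fun k : ℕ => s / ((k : ℝ) + 1)) atTop (𝓝[≠] 0) := by
    refine tendsto_nhdsWithin_iff.2 ⟨?_, Eventually.of_forall fun k => ?_⟩
    · simpa [div_eq_mul_inv] using
        (tendsto_one_div_add_atTop_nhds_zero_nat (𝕜 := ℝ)).const_mul s
    · exact div_ne_zero hs (by positivity)
  -- With t = s/(k+1) the truncation equals s · arctan(t)/t, and the slope of arctan at 0 is 1.
  have hd : Tendsto (fun t => t⁻¹ • (Real.arctan (0 + t) - Real.arctan 0)) (𝓝[≠] 0) (𝓝 1) := by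
    have := (Real.hasDerivAt_arctan 0).tendsto_slope_zero
    simpa using this
  have h2 := (hd.comp h).const_mul s
  rw [mul_one] at h2
  refine h2.congr fun k => ?_
  have hk : (k : ℝ) + 1 ≠ 0 := by positivity
  simp only [Function.comp, zero_add, Real.arctan_zero, sub_zero, smul_eq_mul, softTrunc]
  field_simp

namespace RemovableSetting

variable {n : ℕ} {Ω E : Set (Rn n)} {p ϑ v : Rn n → ℝ} {g V : Rn n → Rn n}
    {b h : Rn n → ℝ} {P μ L : ℝ} {m : ℕ}

/-- The case χ = 1 of `bound_V`, with the factor m ≥ 1 dropped. -/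
theorem norm_V_mul_le (H : RemovableSetting Ω E p ϑ v g V b h P μ L m) :
    ∀ᵐ x ∂(volume.restrict Ω), ∀ Y : ℝ, 0 ≤ Y →
      ‖V x‖ * Y ≤ μ / 2 * (‖g x‖ ^ p x * ϑ x) + L * (Y ^ p x * ϑ x) + h x := by
  filter_upwards [H.bound_V] with x hx Y hY
  have h1 := hx Y 1 hY zero_le_one le_rfl
  simp only [one_pow, mul_one] at h1
  refine le_trans ?_ h1
  exact le_mul_of_one_le_left (by positivity) (by exact_mod_cast H.one_le)

/-- The sub-solution inequality extends across `E`. -/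
theorem sub_across (H : RemovableSetting Ω E p ϑ v g V b h P μ L m) {φ : Rn n → ℝ}
    {dφ : Rn n → Rn n} (hφ : MemW Ω p ϑ φ dφ) (hφ0 : ∀ᵐ x ∂(volume.restrict Ω), 0 ≤ φ x)
    {K : Set (Rn n)} (hK : IsCompact K) (hKΩ : K ⊆ Ω)
    (hφK : ∀ᵐ x ∂(volume.restrict Ω), x ∉ K → φ x = 0) :
    IntegrableOn (fun x => inner ℝ (V x) (dφ x) + b x * φ x) Ω ∧
    ∫ x in Ω, (inner ℝ (V x) (dφ x) + b x * φ x) ≤ 0 := by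
  have hdφK : ∀ᵐ x ∂(volume.restrict Ω), x ∉ K → dφ x = 0 := by
    have h1 := hφ.grad.ae_grad_eq_zero (V := Ω \ K) (H.isOpen.sdiff hK.isClosed)
      Set.sdiff_subset (by
        rw [ae_restrict_iff' H.isOpen.measurableSet] at hφK
        filter_upwards [hφK] with x hx hxK
        exact hx hxK.1 hxK.2)
    rw [ae_restrict_iff' H.isOpen.measurableSet]
    filter_upwards [h1] with x hx hxΩ hxK
    exact hx ⟨hxΩ, hxK⟩
  have hpP : ∀ᵐ x ∂(volume.restrict Ω), 0 ≤ p x ∧ p x ≤ P :=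
    H.exp.mono fun x hx => ⟨by linarith [hx.1], hx.2⟩
  have hϑ0 : ∀ᵐ x ∂(volume.restrict Ω), 0 ≤ ϑ x := H.weight.pos.mono fun x hx => hx.le
  have iφ := hφ.mem.integrableOn H.meas_exp H.aestronglyMeasurable_weight hpP hϑ0
  have idφ := hφ.mem_grad.integrableOn H.meas_exp H.aestronglyMeasurable_weight hpP hϑ0
  have mφ := hφ.grad.locInt.aestronglyMeasurable
  have mdφ := hφ.grad.locInt_grad.aestronglyMeasurable
  have iG := H.integrableOn_grad hK hKΩ
  have ih := H.locInt.integrableOn_compact_subset hKΩ hK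
  -- An integrable majorant independent of `ε` and `k`: truncation increases neither |φ| nor |dφ|,
  -- so `W` dominates every integrand used in both limits. Its integrability on `K` uses the
  -- Caccioppoli estimate.
  set W : Rn n → ℝ := K.indicator fun x => μ / 2 * (‖g x‖ ^ p x * ϑ x)
    + L * (‖dφ x‖ ^ p x * ϑ x) + h x + (L * (‖φ x‖ ^ p x * ϑ x) + h x) with hW
  have iW : IntegrableOn W Ω := by
    refine Integrable.integrableOn ?_
    rw [hW, integrable_indicator_iff hK.isClosed.measurableSet]
    exact (((iG.const_mul _).add ((idφ.mono_set hKΩ).const_mul _)).add ih).add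
      (((iφ.mono_set hKΩ).const_mul _).add ih)
  have hWle : ∀ᵐ x ∂(volume.restrict Ω), ‖V x‖ * ‖dφ x‖ + |b x| * |φ x| ≤ W x := by
    filter_upwards [H.norm_V_mul_le, H.bound_b, hφK, hdφK] with x h1 h2 h3 h4
    by_cases hxK : x ∈ K
    · rw [hW, Set.indicator_of_mem hxK]
      exact add_le_add (h1 _ (norm_nonneg _)) (h2 _ (abs_nonneg _))
    · rw [hW, Set.indicator_of_notMem hxK, h3 hxK, h4 hxK]
      simp
  have hdom : ∀ᵐ x ∂(volume.restrict Ω), ∀ (w : Rn n) (s : ℝ), ‖w‖ ≤ ‖dφ x‖ → |s| ≤ |φ x| →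
      ‖inner ℝ (V x) w + b x * s‖ ≤ W x := by
    filter_upwards [hWle] with x hx w s hw hs
    refine le_trans ((norm_add_le _ _).trans (add_le_add ?_ ?_)) hx
    · exact (norm_inner_le_norm _ _).trans (by gcongr)
    · rw [norm_mul, Real.norm_eq_abs, Real.norm_eq_abs]
      gcongr
  obtain ⟨c, ξ, hc0, hξ, hξ1⟩ := H.exists_cutoff_family
  obtain ⟨ζ, hζ, hζc, hζΩ, hζI, hζ1⟩ := exists_smooth_cutoff hK H.isOpen hKΩ
  -- Truncation precedes the cutoff because the term φ ∇ξ_ε is controlled by the decay only when the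
  -- factor φ is bounded.
  have step : ∀ k : ℕ, ∫ x in Ω, (inner ℝ (V x) (deriv (softTrunc k) (φ x) • dφ x)
      + b x * softTrunc k (φ x)) ≤ 0 := by
    intro k
    set f : Rn n → ℝ := fun x => softTrunc k (φ x) with hf
    set df : Rn n → Rn n := fun x => deriv (softTrunc k) (φ x) • dφ x with hdf
    have hw : HasWeakGrad Ω f df := hφ.grad.comp_left H.isOpen (contDiff_softTrunc k)
      (abs_softTrunc_le k) (L := 1) (fun s => by
        rw [abs_of_nonneg (deriv_softTrunc_nonneg k s)]; exact deriv_softTrunc_le_one k s)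
    have hfle : ∀ x, |f x| ≤ |φ x| := fun x => abs_softTrunc_le_abs k _
    have hdfle : ∀ x, ‖df x‖ ≤ ‖dφ x‖ := fun x => by
      simp only [hdf, norm_smul, Real.norm_of_nonneg (deriv_softTrunc_nonneg k _)]
      exact mul_le_of_le_one_left (norm_nonneg _) (deriv_softTrunc_le_one k _)
    have mf := hw.locInt.aestronglyMeasurable
    have mdf := hw.locInt_grad.aestronglyMeasurable
    have iF : IntegrableOn (fun x => ‖f x‖ ^ p x * ϑ x) Ω := by
      refine Integrable.mono' iφ
        (aestronglyMeasurable_norm_rpow_mul H.meas_exp H.aestronglyMeasurable_weight mf) ?_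
      filter_upwards [hpP, hϑ0] with x h1 h2
      rw [Real.norm_of_nonneg (by positivity)]
      gcongr
      · exact h1.1
      · exact hfle x
    have idF : IntegrableOn (fun x => ‖df x‖ ^ p x * ϑ x) Ω := by
      refine Integrable.mono' idφ
        (aestronglyMeasurable_norm_rpow_mul H.meas_exp H.aestronglyMeasurable_weight mdf) ?_
      filter_upwards [hpP, hϑ0] with x h1 h2
      rw [Real.norm_of_nonneg (by positivity)]
      gcongr
      · exact h1.1
      · exact hdfle x
    set I : Rn n → ℝ := fun x => inner ℝ (V x) (df x) + b x * f x with hI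
    have mI : AEStronglyMeasurable I (volume.restrict Ω) :=
      (H.meas_V.inner mdf).add (H.meas_b.mul mf)
    have hIW : ∀ᵐ x ∂(volume.restrict Ω), ‖I x‖ ≤ W x := by
      filter_upwards [hdom] with x hx
      exact hx _ _ (hdfle x) (hfle x)
    have lim1 : Tendsto (fun ε => ∫ x in Ω, ξ ε x * I x) (𝓝[>] 0) (𝓝 (∫ x in Ω, I x)) := by
      refine tendsto_integral_filter_of_dominated_convergence W ?_ ?_ iW ?_
      · filter_upwards [self_mem_nhdsWithin] with ε hε
        exact (hξ ε hε).1.continuous.aestronglyMeasurable.mul mI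
      · filter_upwards [self_mem_nhdsWithin] with ε hε
        filter_upwards [hIW] with x hx
        obtain ⟨h0, h1⟩ := (hξ ε hε).2.1 x
        rw [norm_mul, Real.norm_of_nonneg h0]
        exact (mul_le_of_le_one_left (norm_nonneg _) h1).trans hx
      · filter_upwards [hξ1] with x hx
        refine tendsto_const_nhds.congr' ?_
        filter_upwards [hx] with ε hε
        rw [hε, one_mul]
    set N : ℝ := (k + 1) * (Real.pi / 2) with hN
    have hN0 : 0 ≤ N := by positivity
    -- Taking Y = c/ε in the bound for `V` leaves an integrable function on `K` and a multiple of
    -- ε^{-P} ϑ on the shell; the latter is covered by the summand 1 in `decay`.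
    have lim2 : Tendsto (fun ε => ∫ x in Ω, f x * inner ℝ (V x) (gradient (ξ ε) x))
        (𝓝[>] 0) (𝓝 0) := by
      have hL := H.nonneg
      refine H.tendsto_integral_shell
        (G := K.indicator fun x => N * (μ / 2 * (‖g x‖ ^ p x * ϑ x) + h x)) ?_
        (c := N * L * max 1 c ^ P) (by positivity) ?_
      · refine Integrable.integrableOn ?_
        rw [integrable_indicator_iff hK.isClosed.measurableSet]
        exact ((iG.const_mul _).add ih).const_mul N
      · filter_upwards [self_mem_nhdsWithin,
          (eventually_lt_nhds (zero_lt_one (α := ℝ))).filter_mono nhdsWithin_le_nhds]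
          with ε hε hε1
        have hε0 : 0 < ε := hε
        obtain ⟨-, -, -, hn, hz⟩ := hξ ε hε
        filter_upwards [H.exp, H.weight.pos, H.v_nonneg, H.norm_V_mul_le, hφK,
          ae_restrict_mem H.isOpen.measurableSet] with x hp hϑ hv hV hx0 hxΩ
        by_cases hxs : x ∈ distShell Ω E ε
        · rw [Set.indicator_of_mem hxs]
          by_cases hxK : x ∈ K
          · rw [Set.indicator_of_mem hxK]
            have e1 := hV (c / ε) (by positivity)
            have e3 := div_mul_rpow_le (s := 1) hc0 hε0 hε1.le zero_le_one
              (by linarith [hp.1]) hp.2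
            rw [mul_one, Real.one_rpow, mul_one] at e3
            have e4 : |f x * inner ℝ (V x) (gradient (ξ ε) x)| ≤ N * (‖V x‖ * (c / ε)) := by
              rw [abs_mul]
              gcongr
              · exact abs_softTrunc_le k _
              · refine (abs_real_inner_le_norm _ _).trans ?_
                gcongr
                exact hn x
            calc _ ≤ N * (‖V x‖ * (c / ε)) := e4
              _ ≤ N * (μ / 2 * (‖g x‖ ^ p x * ϑ x) + L * ((c / ε) ^ p x * ϑ x) + h x) := by
                  gcongr
              _ ≤ N * (μ / 2 * (‖g x‖ ^ p x * ϑ x)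
                  + L * (max 1 c ^ P * ε ^ (-P) * ϑ x) + h x) := by gcongr
              _ = N * (μ / 2 * (‖g x‖ ^ p x * ϑ x) + h x)
                  + N * L * max 1 c ^ P * (ε ^ (-P) * (1 * ϑ x)) := by ring
              _ ≤ _ := by
                  gcongr
                  · exact le_abs_self _
                  · linarith [Real.rpow_nonneg hv (p x)]
          · simp only [hf, hx0 hxK, softTrunc_zero, zero_mul, abs_zero]
            positivity
        · rw [Set.indicator_of_notMem hxs, hz x hxΩ hxs]
          simp
    have lim := lim1.add lim2
    rw [add_zero] at lim
    refine le_of_tendsto lim ?_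
    filter_upwards [self_mem_nhdsWithin] with ε hε
    obtain ⟨hs, hsI, hsupp, -, -⟩ := hξ ε hε
    -- The factor ζ only supplies compact support: it equals 1 near `K`, and off `K` both `f` and
    -- `df` vanish almost everywhere.
    set η : Rn n → ℝ := fun x => ζ x * ξ ε x with hη
    have hηs : ContDiff ℝ ((⊤ : ℕ∞) : WithTop ℕ∞) η := hζ.mul hs
    have hηc : HasCompactSupport η := hζc.mul_right
    have hηΩ : tsupport η ⊆ Ω :=
      (tsupport_mul_subset_left (f := ζ) (g := ξ ε)).trans hζΩ
    have hηE : tsupport η ⊆ Eᶜ :=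
      (tsupport_mul_subset_right (f := ζ) (g := ξ ε)).trans hsupp
    have hmem := hw.memW_smooth_mul H.isOpen H.isOpen subset_rfl H.meas_exp
      H.aestronglyMeasurable_weight (H.exp.mono fun x hx => ⟨by linarith [hx.1], hx.2⟩) hϑ0
      (fun K _ hKU => iF.mono_set hKU) (fun K _ hKU => idF.mono_set hKU) hηs hηc hηΩ
    obtain ⟨hint, hle⟩ := H.sub _ _ hmem
      (hφ0.mono fun x hx => mul_nonneg (mul_nonneg (hζI x).1 (hsI x).1) (softTrunc_nonneg k hx))
      ⟨tsupport η, hηc, fun x hx => ⟨hηΩ hx, hηE hx⟩, Eventually.of_forall fun x hx => by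
        rw [image_eq_zero_of_notMem_tsupport hx, zero_mul]⟩
    rw [IntegrableOn, H.restrict_diff] at hint
    rw [H.restrict_diff] at hle
    have hae : ∀ᵐ x ∂(volume.restrict Ω),
        inner ℝ (V x) (η x • df x + f x • gradient η x) + b x * (η x * f x)
        = ξ ε x * I x + f x * inner ℝ (V x) (gradient (ξ ε) x) := by
      filter_upwards [hφK, hdφK] with x h1 h2
      by_cases hxK : x ∈ K
      · have hev : η =ᶠ[𝓝 x] ξ ε := by
          have hζe : ∀ᶠ y in 𝓝 x, ζ y = 1 := hζ1.filter_mono (nhds_le_nhdsSet hxK)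
          filter_upwards [hζe] with y hy
          simp [hη, hy]
        have hg : gradient η x = gradient (ξ ε) x := by
          simp only [gradient, hev.fderiv_eq]
        rw [hg, hev.self_of_nhds]
        simp only [hI, inner_add_right, inner_smul_right]
        ring
      · simp [hI, hf, hdf, h1 hxK, h2 hxK, softTrunc_zero]
    have iξI : Integrable (fun x => ξ ε x * I x) (volume.restrict Ω) := by
      refine iW.mono' (hs.continuous.aestronglyMeasurable.mul mI) ?_
      filter_upwards [hIW] with x hx
      obtain ⟨h0, h1⟩ := hsI x
      rw [norm_mul, Real.norm_of_nonneg h0]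
      exact (mul_le_of_le_one_left (norm_nonneg _) h1).trans hx
    have isum := hint.congr hae
    have i2 : Integrable (fun x => f x * inner ℝ (V x) (gradient (ξ ε) x))
        (volume.restrict Ω) := by
      refine (isum.sub iξI).congr (Eventually.of_forall fun x => ?_)
      simp
    rw [← integral_add iξI i2, ← integral_congr_ae hae]
    exact hle
  refine ⟨iW.mono' ((H.meas_V.inner mdφ).add (H.meas_b.mul mφ)) ?_, ?_⟩
  · filter_upwards [hdom] with x hx
    exact hx _ _ le_rfl le_rfl
  · refine le_of_tendsto' (tendsto_integral_of_dominated_convergence W (fun k => ?_) iW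
      (fun k => ?_) ?_) step
    · exact (H.meas_V.inner ((((contDiff_softTrunc k).continuous_deriv (by simp)).comp_aestronglyMeasurable
        mφ).smul mdφ)).add (H.meas_b.mul
        ((contDiff_softTrunc k).continuous.comp_aestronglyMeasurable mφ))
    · filter_upwards [hdom] with x hx
      refine hx _ _ ?_ (abs_softTrunc_le_abs k _)
      rw [norm_smul, Real.norm_of_nonneg (deriv_softTrunc_nonneg k _)]
      exact mul_le_of_le_one_left (norm_nonneg _) (deriv_softTrunc_le_one k _)
    · refine Eventually.of_forall fun x => ?_
      refine Tendsto.add ?_ ((tendsto_softTrunc _).const_mul _)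
      have := (tendsto_deriv_softTrunc (φ x)).mul_const (inner ℝ (V x) (dφ x))
      rw [one_mul] at this
      simpa only [inner_smul_right] using this

end RemovableSetting

/-! ### From the growth conditions to the abstract bounds. -/

theorem ae_le_supOn {n : ℕ} {Ω : Set (Rn n)} {f : Rn n → ℝ} {c : ℝ}
    (h : ∀ᵐ x ∂(volume.restrict Ω), f x ≤ c) : ∀ᵐ x ∂(volume.restrict Ω), f x ≤ supOn Ω f :=
  ae_le_essSup ⟨c, h⟩

theorem infOn_ae_le {n : ℕ} {Ω : Set (Rn n)} {f : Rn n → ℝ} {c : ℝ}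
    (h : ∀ᵐ x ∂(volume.restrict Ω), c ≤ f x) : ∀ᵐ x ∂(volume.restrict Ω), infOn Ω f ≤ f x :=
  ae_essInf_le ⟨c, h⟩

/-- The growth bound for the principal part, tested against `Y` and a power of a cutoff. -/
theorem growth_mul_pow_le {s t a w Y χ p P μ : ℝ} {m : ℕ} (hs : 0 ≤ s) (ht : 0 ≤ t) (ha : 0 ≤ a)
    (hw : 0 ≤ w) (hY : 0 ≤ Y) (hχ : 0 ≤ χ) (hχ1 : χ ≤ 1) (hp : 1 < p) (hpP : p ≤ P)
    (hPm : P ≤ m) (hμ : 0 < μ) :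
    m * ((μ⁻¹ * s ^ (p - 1) + μ⁻¹ * t ^ (p - 1) + a) * w * χ ^ (m - 1) * Y) ≤
      μ / 2 * (s ^ p * w) * χ ^ m
      + (m * μ⁻¹ * (min 1 (μ ^ 2 / (2 * m)))⁻¹ ^ P + m * μ⁻¹ + m) * (Y ^ p * w)
      + (m * μ⁻¹ * t ^ p + m * a ^ (p / (p - 1))) * w := by
  have hp0 : 0 < p := by linarith
  have hm : (1 : ℝ) < m := by linarith
  have hm1 : 1 ≤ m := by exact_mod_cast hm.le
  -- Chosen so that m μ⁻¹ δ ≤ μ/2, the admissible share of the coercive term.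
  set δ : ℝ := min 1 (μ ^ 2 / (2 * m)) with hδ
  have hδ0 : 0 < δ := by rw [hδ]; positivity
  have hχm : χ ^ (m - 1) ≤ 1 := pow_le_one₀ hχ hχ1
  have hχm0 : 0 ≤ χ ^ (m - 1) := pow_nonneg hχ _
  have t1 : s ^ (p - 1) * χ ^ (m - 1) * Y ≤ δ * (s ^ p * χ ^ m) + δ⁻¹ ^ P * Y ^ p := by
    -- With this X one has X^p = s^p χ^m, while X^{p-1} carries χ^{m(p-1)/p}. That dominates χ^{m-1}
    -- because χ ≤ 1 and p ≤ m; this is why the power of the cutoff must be at least P.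
    have h1 := rpow_sub_one_mul_le (X := s * χ ^ ((m : ℝ) / p)) (by positivity) hY hp hpP hδ0
      (min_le_left _ _)
    rw [Real.mul_rpow hs (by positivity), Real.mul_rpow hs (by positivity), ← Real.rpow_mul hχ,
      ← Real.rpow_mul hχ, div_mul_cancel₀ _ hp0.ne', Real.rpow_natCast] at h1
    refine le_trans ?_ h1
    gcongr
    rcases hχ.eq_or_lt with rfl | hχ0
    · rw [zero_pow (by
        have : 1 < m := by exact_mod_cast hm
        omega)]
      positivity
    · rw [← Real.rpow_natCast]
      refine Real.rpow_le_rpow_of_exponent_ge hχ0 hχ1 ?_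
      rw [Nat.cast_sub hm1, Nat.cast_one, div_mul_eq_mul_div, div_le_iff₀ hp0]
      nlinarith
  have t2 : t ^ (p - 1) * χ ^ (m - 1) * Y ≤ t ^ p + Y ^ p := by
    have h1 := rpow_sub_one_mul_le ht hY hp hpP one_pos le_rfl
    rw [inv_one, Real.one_rpow, one_mul, one_mul] at h1
    refine le_trans ?_ h1
    gcongr
    exact mul_le_of_le_one_right (by positivity) hχm
  have t3 : a * χ ^ (m - 1) * Y ≤ a ^ (p / (p - 1)) + Y ^ p := by
    refine le_trans ?_ (mul_le_rpow_conj_add_rpow ha hY hp)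
    gcongr
    exact mul_le_of_le_one_right ha hχm
  have hmδ : m * μ⁻¹ * δ ≤ μ / 2 := by
    calc m * μ⁻¹ * δ ≤ m * μ⁻¹ * (μ ^ 2 / (2 * m)) := by
          gcongr
          exact min_le_right _ _
      _ = μ / 2 := by field_simp
  calc m * ((μ⁻¹ * s ^ (p - 1) + μ⁻¹ * t ^ (p - 1) + a) * w * χ ^ (m - 1) * Y)
      = (m * μ⁻¹ * (s ^ (p - 1) * χ ^ (m - 1) * Y) + m * μ⁻¹ * (t ^ (p - 1) * χ ^ (m - 1) * Y)
        + m * (a * χ ^ (m - 1) * Y)) * w := by ring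
    _ ≤ (m * μ⁻¹ * (δ * (s ^ p * χ ^ m) + δ⁻¹ ^ P * Y ^ p) + m * μ⁻¹ * (t ^ p + Y ^ p)
        + m * (a ^ (p / (p - 1)) + Y ^ p)) * w := by gcongr
    _ = (m * μ⁻¹ * δ) * (s ^ p * χ ^ m * w)
        + (m * μ⁻¹ * δ⁻¹ ^ P + m * μ⁻¹ + m) * (Y ^ p * w)
        + (m * μ⁻¹ * t ^ p + m * a ^ (p / (p - 1))) * w := by ring
    _ ≤ μ / 2 * (s ^ p * χ ^ m * w)
        + (m * μ⁻¹ * δ⁻¹ ^ P + m * μ⁻¹ + m) * (Y ^ p * w)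
        + (m * μ⁻¹ * t ^ p + m * a ^ (p / (p - 1))) * w := by gcongr
    _ = _ := by ring

theorem growth_lower_order_le {t a w Y p μ : ℝ} (ht : 0 ≤ t) (ha : 0 ≤ a)
    (hw : 0 ≤ w) (hY : 0 ≤ Y) (hp : 1 < p) (hμ : 0 < μ) :
    (μ⁻¹ * t ^ (p - 1) + a) * w * Y ≤
      (μ⁻¹ + 1) * (Y ^ p * w) + (μ⁻¹ * t ^ p + a ^ (p / (p - 1))) * w := by
  have h1 := rpow_sub_one_mul_le ht hY hp le_rfl one_pos le_rfl
  rw [inv_one, Real.one_rpow, one_mul, one_mul] at h1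
  have h2 := mul_le_rpow_conj_add_rpow ha hY hp
  calc (μ⁻¹ * t ^ (p - 1) + a) * w * Y = (μ⁻¹ * (t ^ (p - 1) * Y) + a * Y) * w := by ring
    _ ≤ (μ⁻¹ * (t ^ p + Y ^ p) + (a ^ (p / (p - 1)) + Y ^ p)) * w := by gcongr
    _ = _ := by ring

/-- Membership in a variable exponent space gives local integrability of lower powers. -/
theorem MemLVar.locallyIntegrableOn_rpow {n : ℕ} {Ω : Set (Rn n)} (hΩ : IsOpen Ω)
    {q r ϑ : Rn n → ℝ} (hq : IsExponent Ω q) (hr : AEMeasurable r (volume.restrict Ω))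
    (hrq : ∀ᵐ x ∂(volume.restrict Ω), 0 ≤ r x ∧ r x ≤ q x) (hϑ : LocallyIntegrableOn ϑ Ω)
    (hϑ0 : ∀ᵐ x ∂(volume.restrict Ω), 0 < ϑ x) {f : Rn n → ℝ} (hf : MemLVar Ω q ϑ f) :
    LocallyIntegrableOn (fun x => |f x| ^ r x * ϑ x) Ω := by
  obtain ⟨hqm, a, c, ha, hac⟩ := hq
  have h1 := hf.integrableOn (P := c) hqm hϑ.aestronglyMeasurable
    (hac.mono fun x hx => ⟨by linarith [hx.1], hx.2⟩) (hϑ0.mono fun x hx => hx.le)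
  refine locallyIntegrableOn_of_norm_le hΩ (h1.locallyIntegrableOn.add hϑ)
    (aestronglyMeasurable_norm_rpow_mul hr hϑ.aestronglyMeasurable hf.1) ?_
  filter_upwards [hrq, hϑ0] with x hx h0
  rw [Real.norm_of_nonneg (by positivity)]
  refine le_trans ?_ (le_abs_self _)
  simp only [Pi.add_apply, Real.norm_eq_abs]
  rw [← add_one_mul]
  gcongr
  -- In either case |f|^r ≤ |f|^q + 1, and the 1 is absorbed by the local integrability of ϑ.
  rcases le_total |f x| 1 with h | h
  · have := Real.rpow_le_one (abs_nonneg _) h hx.1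
    have : 0 ≤ |f x| ^ q x := by positivity
    linarith
  · have := Real.rpow_le_rpow_of_exponent_le h hx.2
    linarith

/-- Vanishing upper Minkowski content controls the weighted volume of neighbourhoods of `E`. -/
theorem tendsto_lintegral_thickening {n : ℕ} {Ω E : Set (Rn n)} {α ϑ : Rn n → ℝ} {D : ℝ}
    (hM : upperMinkowski Ω α ϑ E = 0) (hϑ : ∀ᵐ x ∂(volume.restrict Ω), 0 < ϑ x)
    (hα : ∀ᵐ x ∂(volume.restrict Ω), α x - n ≤ -D) :
    Tendsto (fun ε : ℝ => ∫⁻ x in Metric.thickening ε E ∩ Ω, ENNReal.ofReal (ε ^ (-D) * ϑ x))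
      (𝓝[>] 0) (𝓝 0) := by
  have h0 : Tendsto (fun ε : ℝ => ∫⁻ x in Metric.thickening ε E ∩ Ω,
      ENNReal.ofReal (ε ^ (α x - (n : ℝ)) * ϑ x)) (𝓝[>] 0) (𝓝 0) :=
    tendsto_of_le_liminf_of_limsup_le zero_le hM.le
  refine tendsto_of_tendsto_of_tendsto_of_le_of_le' tendsto_const_nhds h0
    (Eventually.of_forall fun _ => zero_le) ?_
  filter_upwards [self_mem_nhdsWithin,
    (eventually_lt_nhds (zero_lt_one (α := ℝ))).filter_mono nhdsWithin_le_nhds] with ε hε hε1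
  refine lintegral_mono_ae (ae_restrict_of_ae_restrict_of_subset Set.inter_subset_right ?_)
  filter_upwards [hϑ, hα] with x h1 h2
  refine ENNReal.ofReal_le_ofReal (mul_le_mul_of_nonneg_right ?_ h1.le)
  exact Real.rpow_le_rpow_of_exponent_ge hε hε1.le h2

/-- For ε < 1 the factor ε^{-D} is at least 1, so the integral of ϑ over `E` is below quantities
tending to zero; as ϑ > 0 almost everywhere, `E` is null. -/
theorem volume_eq_zero_of_tendsto {n : ℕ} {Ω E : Set (Rn n)} {ϑ : Rn n → ℝ} {D : ℝ}
    (hEΩ : E ⊆ Ω) (hD : 0 ≤ D)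
    (hϑm : AEStronglyMeasurable ϑ (volume.restrict Ω))
    (hϑ : ∀ᵐ x ∂(volume.restrict Ω), 0 < ϑ x)
    (h : Tendsto (fun ε : ℝ => ∫⁻ x in Metric.thickening ε E ∩ Ω,
      ENNReal.ofReal (ε ^ (-D) * ϑ x)) (𝓝[>] 0) (𝓝 0)) : volume E = 0 := by
  have h1 : ∫⁻ x in E, ENNReal.ofReal (ϑ x) = 0 := by
    refine le_antisymm (ge_of_tendsto h ?_) zero_le
    filter_upwards [self_mem_nhdsWithin,
      (eventually_lt_nhds (zero_lt_one (α := ℝ))).filter_mono nhdsWithin_le_nhds] with ε hε hε1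
    have hε : 0 < ε := hε
    refine (lintegral_mono_set (t := Metric.thickening ε E ∩ Ω)
      (Set.subset_inter (Metric.self_subset_thickening hε E) hEΩ)).trans ?_
    refine lintegral_mono_ae (ae_restrict_of_ae_restrict_of_subset Set.inter_subset_right ?_)
    filter_upwards [hϑ] with x hx
    refine ENNReal.ofReal_le_ofReal (le_mul_of_one_le_left hx.le ?_)
    exact Real.one_le_rpow_of_pos_of_le_one_of_nonpos hε hε1.le (by linarith)
  rw [lintegral_eq_zero_iff'] at h1
  · rw [← Measure.restrict_eq_zero, ← ae_eq_bot]
    refine eventually_false_iff_eq_bot.1 ?_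
    filter_upwards [h1, ae_restrict_of_ae_restrict_of_subset hEΩ hϑ] with x hx hx'
    simp only [Pi.zero_apply, ENNReal.ofReal_eq_zero] at hx
    linarith
  · exact (hϑm.mono_measure (Measure.restrict_mono_set _ hEΩ)).aemeasurable.ennreal_ofReal

/-- Replacing the exponent pβ by the constant Q is legitimate for d ≤ 1. For d ≥ 1 the power of d is
at most 1, which accounts for the added 1. -/
theorem rpow_le_of_le_infDist {s d β p P Q C : ℝ} (hs : 0 ≤ s) (hd : 0 < d) (hC : 0 < C)
    (hsd : s ≤ C * d ^ (-β)) (hp : 0 < p) (hpP : p ≤ P) (hβ : 0 ≤ β) (hQ : p * β ≤ Q) :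
    s ^ p ≤ max 1 C ^ P * (d ^ (-Q) + 1) := by
  calc s ^ p ≤ (C * d ^ (-β)) ^ p := by gcongr
    _ ≤ max 1 C ^ P * (d ^ (-β)) ^ p :=
        mul_rpow_le_max_rpow_mul hC.le (by positivity) hp.le hpP
    _ ≤ max 1 C ^ P * (d ^ (-Q) + 1) := by
        gcongr
        rw [← Real.rpow_mul hd.le]
        rcases le_total d 1 with h | h
        · have : d ^ (-β * p) ≤ d ^ (-Q) :=
            Real.rpow_le_rpow_of_exponent_ge hd h (by linarith)
          linarith
        · have : d ^ (-β * p) ≤ 1 := Real.rpow_le_one_of_one_le_of_nonpos h (by nlinarith)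
          have : 0 < d ^ (-Q) := by positivity
          linarith

/-! ### Decay on shells and integrability up to the singular set. -/

section Decay

variable {n : ℕ} {Ω E : Set (Rn n)} {p ϑ v : Rn n → ℝ} {P Q C : ℝ}

/-- On the shell d > ε/4, so d^{-Q} ≤ 4^Q ε^{-Q}; the constants 1 are absorbed by ε^{-Q} ≥ 1. -/
theorem add_one_mul_le_on_shell (hϑ : ∀ᵐ x ∂(volume.restrict Ω), 0 < ϑ x) (hQ : 0 ≤ Q)
    (hC : 0 ≤ C)
    (hv : ∀ᵐ x ∂(volume.restrict Ω), v x ^ p x ≤ C * (Metric.infDist x E ^ (-Q) + 1))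
    {ε : ℝ} (hε : 0 < ε) (hε1 : ε ≤ 1) : ∀ᵐ x ∂(volume.restrict (distShell Ω E ε)),
      (v x ^ p x + 1) * ϑ x ≤ (C * (4 ^ Q + 1) + 1) * (ε ^ (-Q) * ϑ x) := by
  have hsub : distShell Ω E ε ⊆ Ω := fun x hx => hx.1
  have hmem : ∀ᵐ x ∂(volume.restrict (distShell Ω E ε)), ε / 4 < Metric.infDist x E := by
    have hcl : MeasurableSet {x | ε / 4 < Metric.infDist x E} :=
      (isOpen_lt continuous_const (Metric.continuous_infDist_pt E)).measurableSet
    refine ae_mono (Measure.restrict_mono_set (t := {x | ε / 4 < Metric.infDist x E}) _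
      fun x hx => hx.2.1) (ae_restrict_mem hcl)
  filter_upwards [hmem, ae_restrict_of_ae_restrict_of_subset hsub hϑ,
    ae_restrict_of_ae_restrict_of_subset hsub hv] with x hx h1 h2
  rw [← mul_assoc]
  gcongr
  have e1 : Metric.infDist x E ^ (-Q) ≤ 4 ^ Q * ε ^ (-Q) := by
    calc Metric.infDist x E ^ (-Q) ≤ (ε / 4) ^ (-Q) :=
          Real.rpow_le_rpow_of_nonpos (by positivity) hx.le (by linarith)
      _ = 4 ^ Q * ε ^ (-Q) := by
          rw [Real.div_rpow hε.le (by norm_num), Real.rpow_neg (by norm_num : (0 : ℝ) ≤ 4),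
            div_inv_eq_mul, mul_comm]
  have e2 : 1 ≤ ε ^ (-Q) :=
    Real.one_le_rpow_of_pos_of_le_one_of_nonpos hε hε1 (by linarith)
  calc v x ^ p x + 1 ≤ C * (4 ^ Q * ε ^ (-Q) + ε ^ (-Q)) + ε ^ (-Q) := by
        refine add_le_add (h2.trans ?_) e2
        gcongr
    _ = _ := by ring

theorem distShell_subset_thickening (hE : E.Nonempty) (ε : ℝ) :
    distShell Ω E ε ⊆ Metric.thickening ε E ∩ Ω := fun _ hx =>
  ⟨(Metric.mem_thickening_iff_infDist_lt hE).2 hx.2.2, hx.1⟩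

theorem tendsto_lintegral_shell (hE : E.Nonempty) (hϑ : ∀ᵐ x ∂(volume.restrict Ω), 0 < ϑ x)
    (hQ : 0 ≤ Q) (hC : 0 ≤ C)
    (hv : ∀ᵐ x ∂(volume.restrict Ω), v x ^ p x ≤ C * (Metric.infDist x E ^ (-Q) + 1))
    (h : Tendsto (fun ε : ℝ => ∫⁻ x in Metric.thickening ε E ∩ Ω,
      ENNReal.ofReal (ε ^ (-(P + Q + 1)) * ϑ x)) (𝓝[>] 0) (𝓝 0)) :
    Tendsto (fun ε : ℝ => ∫⁻ x in distShell Ω E ε,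
      ENNReal.ofReal (ε ^ (-P) * ((v x ^ p x + 1) * ϑ x))) (𝓝[>] 0) (𝓝 0) := by
  have h2 := ENNReal.Tendsto.const_mul (a := ENNReal.ofReal (C * (4 ^ Q + 1) + 1)) h
    (Or.inr ENNReal.ofReal_ne_top)
  rw [mul_zero] at h2
  refine tendsto_of_tendsto_of_tendsto_of_le_of_le' tendsto_const_nhds h2
    (Eventually.of_forall fun _ => zero_le) ?_
  filter_upwards [self_mem_nhdsWithin,
    (eventually_lt_nhds (zero_lt_one (α := ℝ))).filter_mono nhdsWithin_le_nhds] with ε hε hε1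
  have hε : 0 < ε := hε
  have hsub : distShell Ω E ε ⊆ Ω := fun x hx => hx.1
  rw [← lintegral_const_mul' _ _ ENNReal.ofReal_ne_top]
  refine le_trans (lintegral_mono_ae ?_)
    (lintegral_mono_set (distShell_subset_thickening hE ε))
  filter_upwards [add_one_mul_le_on_shell hϑ hQ hC hv hε hε1.le,
    ae_restrict_of_ae_restrict_of_subset hsub hϑ] with x hx h1
  rw [← ENNReal.ofReal_mul (by positivity)]
  refine ENNReal.ofReal_le_ofReal ?_
  have e1 : ε ^ (-P) * ε ^ (-Q) ≤ ε ^ (-(P + Q + 1)) := by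
    rw [← Real.rpow_add hε]
    exact Real.rpow_le_rpow_of_exponent_ge hε hε1.le (by linarith)
  calc ε ^ (-P) * ((v x ^ p x + 1) * ϑ x)
      ≤ ε ^ (-P) * ((C * (4 ^ Q + 1) + 1) * (ε ^ (-Q) * ϑ x)) := by gcongr
    _ = (C * (4 ^ Q + 1) + 1) * ((ε ^ (-P) * ε ^ (-Q)) * ϑ x) := by ring
    _ ≤ _ := by gcongr

/-- Near `E` the set is covered by dyadic shells. The spare power of ε in the hypothesis bounds the
integral over the shell of radius ε by a multiple of ε, and these bounds form a geometric series.
Away from `E` the pointwise bound on `v` is uniform. -/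
theorem locallyIntegrableOn_rpow_mul (hΩ : IsOpen Ω) (hEc : IsCompact E) (hE : E.Nonempty)
    (hE0 : volume E = 0) (hpm : AEMeasurable p (volume.restrict Ω))
    (hϑi : LocallyIntegrableOn ϑ Ω) (hvm : AEStronglyMeasurable v (volume.restrict Ω))
    (hv0 : ∀ᵐ x ∂(volume.restrict Ω), 0 ≤ v x)
    (hϑ : ∀ᵐ x ∂(volume.restrict Ω), 0 < ϑ x) (hP : 0 ≤ P) (hQ : 0 ≤ Q) (hC : 0 ≤ C)
    (hv : ∀ᵐ x ∂(volume.restrict Ω), v x ^ p x ≤ C * (Metric.infDist x E ^ (-Q) + 1))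
    (h : Tendsto (fun ε : ℝ => ∫⁻ x in Metric.thickening ε E ∩ Ω,
      ENNReal.ofReal (ε ^ (-(P + Q + 1)) * ϑ x)) (𝓝[>] 0) (𝓝 0)) :
    LocallyIntegrableOn (fun x => v x ^ p x * ϑ x) Ω := by
  have hm : AEStronglyMeasurable (fun x => v x ^ p x * ϑ x) (volume.restrict Ω) :=
    ((hvm.aemeasurable.pow hpm).mul hϑi.aestronglyMeasurable.aemeasurable).aestronglyMeasurable
  rw [locallyIntegrableOn_iff hΩ.isLocallyClosed]
  intro K hKΩ hK
  refine ⟨hm.mono_measure (Measure.restrict_mono_set _ hKΩ), ?_⟩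
  rw [hasFiniteIntegral_iff_norm]
  set F : Rn n → ℝ≥0∞ := fun x => ENNReal.ofReal ‖v x ^ p x * ϑ x‖ with hF
  set C' : ℝ := C * (4 ^ Q + 1) + 1 with hC'
  have hev := h.eventually (eventually_lt_nhds zero_lt_one)
  obtain ⟨δ, hδ, hδe⟩ := mem_nhdsGT_iff_exists_Ioo_subset.1 hev
  have hδ : 0 < δ := hδ
  obtain ⟨k₀, hk₀⟩ : ∃ k₀ : ℕ, 2 * (1 / 2 : ℝ) ^ k₀ < min δ 1 := by
    have hmin : 0 < min δ 1 := lt_min hδ one_pos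
    obtain ⟨k, hk⟩ := exists_pow_lt_of_lt_one (half_pos hmin) (one_half_lt_one (α := ℝ))
    exact ⟨k, by linarith⟩
  -- A shell of outer radius 2 · 2^{-j} has inner radius 2^{-(j+1)}, so it contains all points of
  -- `Ω` with 2^{-(j+1)} < d ≤ 2^{-j}; the overlap takes care of the endpoint.
  set e : ℕ → ℝ := fun k => 2 * (1 / 2 : ℝ) ^ (k₀ + k) with he
  have he0 : ∀ k, 0 < e k := fun k => by positivity
  have hele : ∀ k, e k < min δ 1 := fun k => by
    refine lt_of_le_of_lt ?_ hk₀
    simp only [he]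
    gcongr 2 * ?_
    exact pow_le_pow_of_le_one (by norm_num) (by norm_num) (Nat.le_add_right _ _)
  have hshell : ∀ k, ∫⁻ x in distShell Ω E (e k), F x ≤ ENNReal.ofReal (C' * e k) := by
    intro k
    have h1 : ∫⁻ x in Metric.thickening (e k) E ∩ Ω,
        ENNReal.ofReal (e k ^ (-(P + Q + 1)) * ϑ x) ≤ 1 :=
      le_of_lt (hδe ⟨he0 k, (hele k).trans_le (min_le_left _ _)⟩)
    have hε1 : e k ≤ 1 := (hele k).le.trans (min_le_right _ _)
    have hsub : distShell Ω E (e k) ⊆ Ω := fun x hx => hx.1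
    calc ∫⁻ x in distShell Ω E (e k), F x
        ≤ ∫⁻ x in distShell Ω E (e k), ENNReal.ofReal (C' * e k) *
          ENNReal.ofReal (e k ^ (-(P + Q + 1)) * ϑ x) := by
          refine lintegral_mono_ae ?_
          filter_upwards [add_one_mul_le_on_shell hϑ hQ hC hv (he0 k) hε1,
            ae_restrict_of_ae_restrict_of_subset hsub hϑ,
            ae_restrict_of_ae_restrict_of_subset hsub hv0] with x hx h1 h2
          rw [← ENNReal.ofReal_mul (mul_nonneg (by positivity) (he0 k).le)]
          refine ENNReal.ofReal_le_ofReal ?_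
          rw [Real.norm_of_nonneg (by positivity)]
          have e1 : e k ^ (-Q) ≤ e k * e k ^ (-(P + Q + 1)) := by
            rw [mul_comm, ← Real.rpow_add_one (he0 k).ne']
            exact Real.rpow_le_rpow_of_exponent_ge (he0 k) hε1 (by linarith)
          calc v x ^ p x * ϑ x ≤ (v x ^ p x + 1) * ϑ x := by gcongr; linarith
            _ ≤ C' * (e k ^ (-Q) * ϑ x) := hx
            _ ≤ C' * ((e k * e k ^ (-(P + Q + 1))) * ϑ x) := by gcongr
            _ = _ := by ring
      _ ≤ ENNReal.ofReal (C' * e k) * ∫⁻ x in Metric.thickening (e k) E ∩ Ω,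
          ENNReal.ofReal (e k ^ (-(P + Q + 1)) * ϑ x) := by
          rw [lintegral_const_mul' _ _ ENNReal.ofReal_ne_top]
          gcongr
          exact distShell_subset_thickening hE _
      _ ≤ ENNReal.ofReal (C' * e k) * 1 := by gcongr
      _ = _ := mul_one _
  set r : ℝ := (1 / 2 : ℝ) ^ k₀ with hr
  have hr0 : 0 < r := by positivity
  have hcover : K ⊆ (E ∪ (K ∩ {x | r ≤ Metric.infDist x E})) ∪ ⋃ k, distShell Ω E (e k) := by
    intro x hx
    by_cases hxE : x ∈ E
    · exact Or.inl (Or.inl hxE)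
    rcases le_or_gt r (Metric.infDist x E) with hd | hd
    · exact Or.inl (Or.inr ⟨hx, hd⟩)
    · right
      have hpos : 0 < Metric.infDist x E := (hEc.isClosed.notMem_iff_infDist_pos hE).1 hxE
      have hr1 : r ≤ 1 := pow_le_one₀ (by norm_num) (by norm_num)
      obtain ⟨j, hj1, hj2⟩ := exists_nat_pow_near_of_lt_one hpos (hd.le.trans hr1)
        (by norm_num : (0 : ℝ) < 1 / 2) (by norm_num)
      have hjk : k₀ ≤ j := by
        by_contra hlt
        have : (1 / 2 : ℝ) ^ k₀ ≤ (1 / 2) ^ (j + 1) :=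
          pow_le_pow_of_le_one (by norm_num) (by norm_num) (by omega)
        linarith
      refine Set.mem_iUnion.2 ⟨j - k₀, hKΩ hx, ?_, ?_⟩
      · simp only [he, Nat.add_sub_cancel' hjk]
        rw [pow_succ] at hj1
        linarith
      · simp only [he, Nat.add_sub_cancel' hjk]
        have : (0 : ℝ) < (1 / 2) ^ j := by positivity
        linarith
  have hfar : ∫⁻ x in K ∩ {x | r ≤ Metric.infDist x E}, F x < ⊤ := by
    have hi : IntegrableOn (fun x => C * (r ^ (-Q) + 1) * ϑ x) K :=
      (hϑi.integrableOn_compact_subset hKΩ hK).const_mul _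
    have hmr : MeasurableSet {x | r ≤ Metric.infDist x E} :=
      (isClosed_le continuous_const (Metric.continuous_infDist_pt E)).measurableSet
    refine lt_of_le_of_lt ?_ ((hasFiniteIntegral_iff_norm _).1
      (hi.mono_set (Set.inter_subset_left (t := {x | r ≤ Metric.infDist x E}))).2)
    refine lintegral_mono_ae ?_
    have hsub : K ∩ {x | r ≤ Metric.infDist x E} ⊆ Ω := Set.inter_subset_left.trans hKΩ
    filter_upwards [ae_restrict_mem (hK.isClosed.measurableSet.inter hmr),
      ae_restrict_of_ae_restrict_of_subset hsub hϑ, ae_restrict_of_ae_restrict_of_subset hsub hv0,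
      ae_restrict_of_ae_restrict_of_subset hsub hv] with x hx h1 h2 h3
    refine ENNReal.ofReal_le_ofReal ?_
    rw [Real.norm_of_nonneg (by positivity), Real.norm_of_nonneg (by positivity)]
    gcongr
    refine h3.trans ?_
    gcongr ?_ * (?_ + 1)
    exact Real.rpow_le_rpow_of_nonpos hr0 hx.2 (by linarith)
  have hnear : ∫⁻ x in ⋃ k, distShell Ω E (e k), F x < ⊤ := by
    refine (lintegral_iUnion_le _ _).trans_lt ?_
    refine (ENNReal.tsum_le_tsum hshell).trans_lt ?_
    have hs : Summable fun k => C' * e k := by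
      simp only [he, pow_add]
      exact ((summable_geometric_two.mul_left _).mul_left _).mul_left _
    rw [← ENNReal.ofReal_tsum_of_nonneg (fun k => mul_nonneg (by positivity) (he0 k).le) hs]
    exact ENNReal.ofReal_lt_top
  refine lt_of_le_of_lt ((lintegral_mono_set hcover).trans (lintegral_union_le _ _ _)) ?_
  refine ENNReal.add_lt_top.2 ⟨lt_of_le_of_lt (lintegral_union_le _ _ _) ?_, hnear⟩
  refine ENNReal.add_lt_top.2 ⟨?_, hfar⟩
  rw [setLIntegral_measure_zero _ _ hE0]
  exact ENNReal.zero_lt_top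

end Decay

/-! ### Proof of the theorem. -/

/-- An exponent bounded away from 1 has a bounded conjugate exponent. Boundedness is needed for the
real-valued essential supremum to bound the function almost everywhere. -/
theorem IsExponent.div_sub_one_le {n : ℕ} {Ω : Set (Rn n)} {p : Rn n → ℝ} (hp : IsExponent Ω p) :
    ∃ c : ℝ, ∀ᵐ x ∂(volume.restrict Ω), p x / (p x - 1) ≤ c := by
  obtain ⟨-, a, c, ha, hac⟩ := hp
  refine ⟨1 + 1 / (a - 1), hac.mono fun x hx => ?_⟩
  have h1 : 0 < a - 1 := by linarith
  have h2 : 0 < p x - 1 := by linarith [hx.1]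
  have h3 : p x / (p x - 1) = 1 + 1 / (p x - 1) := by field_simp; ring
  rw [h3]
  gcongr
  exact hx.1

theorem IsExponent.conj_ae_le {n : ℕ} {Ω : Set (Rn n)} {p q : Rn n → ℝ} (hp : IsExponent Ω p)
    (hq : IsExponent Ω q) (h : supOn Ω (fun x => p x / (p x - 1)) ≤ infOn Ω q) :
    ∀ᵐ x ∂(volume.restrict Ω), p x / (p x - 1) ≤ q x := by
  obtain ⟨c, hc⟩ := hp.div_sub_one_le
  obtain ⟨-, a, c', -, hac⟩ := hq
  filter_upwards [ae_le_supOn hc, infOn_ae_le (hac.mono fun x hx => hx.1)] with x h1 h2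
  linarith

theorem theorem3p1 {n : ℕ} (hn : 3 ≤ n)
    (Ω : Set (Rn n)) (hΩ : IsOpen Ω) (hΩb : Bornology.IsBounded Ω)
    (E : Set (Rn n)) (hE : IsCompact E) (hEΩ : E ⊆ Ω)
    (p q₁ q₂ q₃ : Rn n → ℝ)
    (hp : IsExponent Ω p) (hq₁ : IsExponent Ω q₁) (hq₂ : IsExponent Ω q₂) (hq₃ : IsExponent Ω q₃)
    (ϑ : Rn n → ℝ) (hϑ : IsWeight Ω p ϑ)
    (α β : Rn n → ℝ) (hα : IsDimFun Ω α) (hβ : IsDimFun Ω β)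
    (a₁ a₂ a₃ : Rn n → ℝ)
    (ha₁ : MemLVar Ω q₁ ϑ a₁) (ha₂ : MemLVar Ω q₂ ϑ a₂) (ha₃ : MemLVar Ω q₃ ϑ a₃)
    (ha₂0 : ∀ᵐ x ∂(volume.restrict Ω), 0 ≤ a₂ x) (ha₃0 : ∀ᵐ x ∂(volume.restrict Ω), 0 ≤ a₃ x)
    (A : Rn n → ℝ → Rn n → Rn n) (B : Rn n → ℝ → ℝ) (hAB : CoeffMeasurable Ω A B)
    (μ : ℝ) (hμ : 0 < μ) (hgrowth : GrowthConditions Ω p ϑ μ a₁ a₂ a₃ A B)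
    (hexp : ExponentConditions Ω p q₁ q₂ q₃ α β)
    (hM : upperMinkowski Ω α ϑ E = 0)
    (u : Rn n → EReal) (hu0 : ∀ᵐ x ∂(volume.restrict (Ω \ E)), 0 ≤ u x)
    (hu : IsSubsolutionOff Ω E p ϑ A B u)
    (C : ℝ) (hC : 0 < C)
    (hbound : ∀ᵐ x ∂(volume.restrict (Ω \ E)),
      u x ≤ ((C * Metric.infDist x E ^ (-β x) : ℝ) : EReal)) :
    SingularityRemoved Ω p ϑ A B u := by
  obtain ⟨g, huE, hsub⟩ := hu
  -- The distance to the empty set is 0 by convention, so this case is separated; nothing then has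
  -- to be removed.
  rcases E.eq_empty_or_nonempty with rfl | hEne
  · exact ⟨g, by simpa using huE.memLoc, by simpa using hsub⟩
  set P := supOn Ω p with hP
  set Q := supOn Ω (fun x => p x * β x) with hQ
  set v : Rn n → ℝ := fun x => (u x).toReal with hv
  obtain ⟨hpm, lo, up, hlo, hlu⟩ := id hp
  have hpP : ∀ᵐ x ∂(volume.restrict Ω), 1 < p x ∧ p x ≤ P := by
    filter_upwards [hlu, ae_le_supOn (hlu.mono fun x hx => hx.2)] with x h1 h2
    exact ⟨by linarith [h1.1], h2⟩
  have hpQ : ∀ᵐ x ∂(volume.restrict Ω), p x * β x ≤ Q := by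
    refine ae_le_supOn (c := up * n) ?_
    filter_upwards [hlu, hβ.2] with x h1 h2
    exact mul_le_mul h1.2 h2.2 h2.1 (by linarith [h1.1, h1.2])
  -- The only use of the bound on (pβ)⁺: it converts the content exponent into the constant exponent
  -- P + Q + 1.
  have hαs : ∀ᵐ x ∂(volume.restrict Ω), α x - n ≤ -(P + Q + 1) := by
    filter_upwards [ae_le_supOn (hα.2.mono fun x hx => hx.2)] with x hx
    linarith [hexp.beta_le]
  -- `Ω` has positive measure, so almost-everywhere bounds hold at some point; such points yield P >
  -- 1 and Q ≥ 0.
  have hne : NeBot (ae (volume.restrict Ω)) := by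
    obtain ⟨y, hy⟩ := hEne
    rw [ae_neBot, Ne, Measure.restrict_eq_zero]
    exact (hΩ.measure_pos volume ⟨y, hEΩ hy⟩).ne'
  have hP1 : 1 < P := by
    obtain ⟨x, hx⟩ := hpP.exists
    linarith [hx.1, hx.2]
  have hQ0 : 0 ≤ Q := by
    obtain ⟨x, h1, h2, h3⟩ := (hpP.and (hpQ.and hβ.2)).exists
    exact (mul_nonneg (by linarith [h1.1]) h3.1).trans h2
  have hdecay := tendsto_lintegral_thickening hM hϑ.pos hαs
  have hϑm := hϑ.locInt.aestronglyMeasurable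
  have hE0 : volume E = 0 := volume_eq_zero_of_tendsto hEΩ (by linarith) hϑm hϑ.pos hdecay
  have hres : volume.restrict (Ω \ E) = volume.restrict Ω :=
    Measure.restrict_congr_set (sdiff_null_ae_eq_self hE0)
  have hEae : ∀ᵐ x ∂(volume.restrict Ω), x ∉ E :=
    ae_restrict_of_ae (measure_eq_zero_iff_ae_notMem.1 hE0)
  have hfin := huE.memLoc.finite
  have hvm := huE.memLoc.grad.locInt.aestronglyMeasurable
  have hgm := huE.memLoc.grad.locInt_grad.aestronglyMeasurable
  rw [hres] at hu0 hbound hfin hvm hgm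
  have hv0 : ∀ᵐ x ∂(volume.restrict Ω), 0 ≤ v x := hu0.mono fun x hx => EReal.toReal_nonneg hx
  have hvp : ∀ᵐ x ∂(volume.restrict Ω),
      v x ^ p x ≤ max 1 C ^ P * (Metric.infDist x E ^ (-Q) + 1) := by
    filter_upwards [hv0, hbound, hfin, hpP, hpQ, hβ.2, hEae] with x h1 h2 h3 h4 h5 h6 h7
    refine rpow_le_of_le_infDist h1 ((hE.isClosed.notMem_iff_infDist_pos hEne).1 h7) hC ?_
      (by linarith [h4.1]) h4.2 h6.1 h5
    rw [← EReal.coe_le_coe_iff, EReal.coe_toReal h3.1 h3.2]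
    exact h2
  have hconj : AEMeasurable (fun x => p x / (p x - 1)) (volume.restrict Ω) :=
    hpm.div (hpm.sub_const 1)
  have hc0 : ∀ᵐ x ∂(volume.restrict Ω), 1 ≤ p x / (p x - 1) := by
    filter_upwards [hpP] with x hx
    rw [one_le_div (by linarith [hx.1])]
    linarith
  have i1 : LocallyIntegrableOn (fun x => |a₁ x| ^ (1 : ℝ) * ϑ x) Ω := by
    refine ha₁.locallyIntegrableOn_rpow hΩ hq₁ (r := fun _ => 1) aemeasurable_const ?_ hϑ.locInt
      hϑ.pos
    filter_upwards [hp.conj_ae_le hq₁ hexp.q₁_ge, hc0] with x h1 h2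
    exact ⟨zero_le_one, h2.trans h1⟩
  have i2 : LocallyIntegrableOn (fun x => |a₂ x| ^ (p x / (p x - 1)) * ϑ x) Ω := by
    refine ha₂.locallyIntegrableOn_rpow hΩ hq₂ hconj ?_ hϑ.locInt hϑ.pos
    filter_upwards [hp.conj_ae_le hq₂ ((le_max_left _ _).trans hexp.q₂_ge), hc0] with x h1 h2
    exact ⟨zero_le_one.trans h2, h1⟩
  have i3 : LocallyIntegrableOn (fun x => |a₃ x| ^ (p x / (p x - 1)) * ϑ x) Ω := by
    refine ha₃.locallyIntegrableOn_rpow hΩ hq₃ hconj ?_ hϑ.locInt hϑ.pos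
    filter_upwards [hp.conj_ae_le hq₃ hexp.q₃_ge, hc0] with x h1 h2
    exact ⟨zero_le_one.trans h2, h1⟩
  have iv : LocallyIntegrableOn (fun x => v x ^ p x * ϑ x) Ω :=
    locallyIntegrableOn_rpow_mul hΩ hE hEne hE0 hpm hϑ.locInt hvm hv0 hϑ.pos
      (by linarith) hQ0 (by positivity) hvp hdecay
  -- A natural power of the cutoff keeps it smooth; the Young inequality for the principal part
  -- requires m ≥ P.
  set m : ℕ := ⌈P⌉₊ with hm
  have hPm : P ≤ m := Nat.le_ceil P
  have hm1 : (1 : ℝ) < m := by linarith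
  set L : ℝ := m * μ⁻¹ * (min 1 (μ ^ 2 / (2 * m)))⁻¹ ^ P + m * μ⁻¹ + m with hL
  -- The sum of all lower order remainders: the 1 is for `rpow_le`, m μ⁻¹ covers the powers of `v`
  -- in the three growth bounds, `a₁` enters linearly, and `a₂`, `a₃` enter with the conjugate
  -- exponent produced by Young's inequality.
  set h : Rn n → ℝ := fun x => (1 + m * μ⁻¹) * (v x ^ p x * ϑ x) + |a₁ x| ^ (1 : ℝ) * ϑ x
    + m * (|a₂ x| ^ (p x / (p x - 1)) * ϑ x) + |a₃ x| ^ (p x / (p x - 1)) * ϑ x with hh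
  have ih : LocallyIntegrableOn h Ω :=
    (((iv.smul (1 + m * μ⁻¹)).add i1).add (i2.smul (m : ℝ))).add i3
  have hδ0 : 0 < min 1 (μ ^ 2 / (2 * m)) := by positivity
  have hμm : μ⁻¹ ≤ m * μ⁻¹ := le_mul_of_one_le_left (by positivity) hm1.le
  have H : RemovableSetting Ω E p ϑ v g (fun x => A x (v x) (g x)) (fun x => B x (v x)) h
      P μ L m :=
    { isOpen := hΩ
      isCompact := hE
      subset := hEΩ
      nonempty := hEne
      null := hE0
      meas_exp := hpm
      exp := hpP
      weight := hϑ
      pos := hμ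
      nonneg := by positivity
      one_le := by exact_mod_cast hm1.le
      v_nonneg := hv0
      rpow_le := by
        filter_upwards [hv0, hϑ.pos] with x h1 h2
        have e1 : 0 ≤ m * μ⁻¹ * (v x ^ p x * ϑ x) := by positivity
        have e2 : 0 ≤ |a₁ x| ^ (1 : ℝ) * ϑ x := by positivity
        have e3 : 0 ≤ m * (|a₂ x| ^ (p x / (p x - 1)) * ϑ x) := by positivity
        have e4 : 0 ≤ |a₃ x| ^ (p x / (p x - 1)) * ϑ x := by positivity
        simp only [hh]
        linarith
      locInt := ih
      grad := huE.memLoc.grad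
      grad_int := fun K hK hKU => by
        have hKΩ : K ⊆ Ω := hKU.trans Set.sdiff_subset
        exact (huE.memLoc.mem_grad K hK hKU).integrableOn (P := P)
          (hpm.mono_measure (Measure.restrict_mono_set _ hKΩ))
          (hϑm.mono_measure (Measure.restrict_mono_set _ hKΩ))
          (ae_restrict_of_ae_restrict_of_subset hKΩ
            (hpP.mono fun x hx => ⟨by linarith [hx.1], hx.2⟩))
          (ae_restrict_of_ae_restrict_of_subset hKΩ (hϑ.pos.mono fun x hx => hx.le))
      meas_V := by
        obtain ⟨A', hA', hAA'⟩ := hAB.measA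
        refine AEMeasurable.aestronglyMeasurable (AEMeasurable.congr
          (hA'.comp_aemeasurable (aemeasurable_id.prodMk
            (hvm.aemeasurable.prodMk hgm.aemeasurable))) ?_)
        filter_upwards [hAA', hv0] with x h1 h2
        exact (h1 _ h2 _).symm
      meas_b := by
        obtain ⟨B', hB', hBB'⟩ := hAB.measB
        refine AEMeasurable.aestronglyMeasurable (AEMeasurable.congr
          (hB'.comp_aemeasurable (aemeasurable_id.prodMk hvm.aemeasurable)) ?_)
        filter_upwards [hBB', hv0] with x h1 h2
        exact (h1 _ h2).symm
      coercive := by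
        filter_upwards [hgrowth.coercive, hv0, hϑ.pos] with x h0 h1 h2
        refine le_trans ?_ (h0 (v x) h1 (g x))
        have e1 : μ⁻¹ * (v x ^ p x * ϑ x) ≤ m * μ⁻¹ * (v x ^ p x * ϑ x) := by gcongr
        have e0 : 0 ≤ v x ^ p x * ϑ x := by positivity
        have e2 : -a₁ x * ϑ x ≤ |a₁ x| ^ (1 : ℝ) * ϑ x := by
          rw [Real.rpow_one]
          gcongr
          exact neg_le_abs _
        have e3 : 0 ≤ m * (|a₂ x| ^ (p x / (p x - 1)) * ϑ x) := by positivity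
        have e4 : 0 ≤ |a₃ x| ^ (p x / (p x - 1)) * ϑ x := by positivity
        simp only [hh]
        linarith
      bound_V := by
        filter_upwards [hgrowth.boundA, hv0, hϑ.pos, ha₂0, hpP] with x h0 h1 h2 h3 h4
        intro Y χ hY hχ hχ1
        have k1 := growth_mul_pow_le (norm_nonneg (g x)) h1 h3 h2.le hY hχ hχ1 h4.1 h4.2 hPm hμ
        have k2 : m * (‖A x (v x) (g x)‖ * χ ^ (m - 1) * Y) ≤ m * ((μ⁻¹ * ‖g x‖ ^ (p x - 1)
            + μ⁻¹ * v x ^ (p x - 1) + a₂ x) * ϑ x * χ ^ (m - 1) * Y) := by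
          gcongr
          exact h0 (v x) h1 (g x)
        refine k2.trans (k1.trans ?_)
        have e0 : 0 ≤ v x ^ p x * ϑ x := by positivity
        have e2 : 0 ≤ |a₁ x| ^ (1 : ℝ) * ϑ x := by positivity
        have e4 : 0 ≤ |a₃ x| ^ (p x / (p x - 1)) * ϑ x := by positivity
        simp only [hh, abs_of_nonneg h3]
        linarith
      bound_b := by
        filter_upwards [hgrowth.boundB, hv0, hϑ.pos, ha₃0, hpP] with x h0 h1 h2 h3 h4
        intro Y hY
        have k1 := growth_lower_order_le h1 h3 h2.le hY h4.1 hμ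
        have k2 : |B x (v x)| * Y ≤ (μ⁻¹ * v x ^ (p x - 1) + a₃ x) * ϑ x * Y := by
          gcongr
          exact h0 (v x) h1
        refine k2.trans (k1.trans ?_)
        have hL1 : μ⁻¹ + 1 ≤ L := by
          have : 0 ≤ m * μ⁻¹ * (min 1 (μ ^ 2 / (2 * m)))⁻¹ ^ P := by positivity
          linarith
        have e5 : (μ⁻¹ + 1) * (Y ^ p x * ϑ x) ≤ L * (Y ^ p x * ϑ x) := by gcongr
        have e0 : 0 ≤ v x ^ p x * ϑ x := by positivity
        have e1 : μ⁻¹ * (v x ^ p x * ϑ x) ≤ m * μ⁻¹ * (v x ^ p x * ϑ x) := by gcongr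
        have e2 : 0 ≤ |a₁ x| ^ (1 : ℝ) * ϑ x := by positivity
        have e3 : 0 ≤ m * (|a₂ x| ^ (p x / (p x - 1)) * ϑ x) := by positivity
        simp only [hh, abs_of_nonneg h3]
        linarith
      decay := tendsto_lintegral_shell hEne hϑ.pos hQ0 (by positivity) hvp hdecay
      sub := hsub }
  refine ⟨g, ⟨hfin, H.hasWeakGrad, fun K hK hKΩ => ?_, fun K hK hKΩ => ?_⟩, ?_⟩
  · exact memLVar_of_integrableOn (hvm.mono_measure (Measure.restrict_mono_set _ hKΩ))
      (H.integrableOn_rpow hK hKΩ)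
  · exact memLVar_of_integrableOn (hgm.mono_measure (Measure.restrict_mono_set _ hKΩ))
      (H.integrableOn_grad hK hKΩ)
  · rintro φ dφ hφ hφ0 ⟨K, hK, hKΩ, hφK⟩
    exact H.sub_across hφ hφ0 hK hKΩ hφK
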